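/- Let $k$ be an algebraically closed, complete, non-trivially valued non-Archimedean field (with real-valued absolute value), let $\phi:\mathbb{P}^1_k\to\mathbb{P}^1_k$ be a finite morphism, and fix a real number $0<c<1$. *Conventions.* For a complete algebraically closed non-Archimedean real-valued extension $L/k$ and a point $x\in\mathbb{P}^{1,\mathrm{an}}_k$ with values in $L$, $x_L\in\mathbb{P}^1(L)$ denotes an $L$-point lying over $x$, and $\phi_L$ the base change of $\phi$. The ball $B(x_L,r)\subset\mathbb{P}^{1,\mathrm{an}}_L$ is $\{|T-x_L|<r\}$ if $x_L\neq\infty$, and $\{|1/T|<r\}$ if $x_L=\infty$. A *Berkovich open ball* of $\mathbb{P}^{1,\mathrm{an}}_L$ is a set $\{|T-a|<r\}$ or $\{|T-a|>r\}\cup\{\infty\}$ with $a\in L$, $r>0$. A ball $B$ *splits* if $(\phi_L^{\mathrm{an}})^{-1}(B)$ is a disjoint union of open sets each mapped homeomorphically onto $B$ by $\phi_L^{\mathrm{an}}$; it *splits into balls* if moreover these open sets can be taken to be Berkovich open balls. A deformation retraction $\psi:[i,e]\times X\to X$ onto $\Upsilon=\psi(e,X)$, where $[i,e]$ is a generalised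 real interval (a finite end-to-end concatenation of closed intervals of $\mathbb{R}\cup\{\infty\}$), is a continuous map with $\psi(i,\cdot)=\mathrm{id}$ and $\psi(t,y)=y$ for all $t$ and all $y\in\Upsilon$. A function $g\ge 0$ on a finite graph $\Upsilon\subset\mathbb{P}^{1,\mathrm{an}}_k$ has *piecewise linear logarithm* if $\Upsilon$ is a union of finitely many vertices and finitely many open segments between vertices such that on each of these segments $\log_c g$ is either an affine function of $\log_c$ of the radius $z\mapsto\inf_{a\in k}|T-a|(z)$, or identically $\infty$ (i.e. $g=0$ there). Consider the following two statements. **(A)** For $x\in\mathbb{P}^{1,\mathrm{an}}_k$ let $f(x)$ be the minimum of $1$ and the radius of the largest ball $B(x_L,r)$, $r>0$, that splits (with $f(x)=0$ if no ball splits, and $f(x)=1$ if balls of arbitrarily large radius split). Then $f$ is well defined (the maximum exists when it should, and $f(x)$ does not depend on $L$ and $x_L$) and not identically zero. There are a generalised real interval $[i,e]$ and a deformation retraction $\psi:[i,e]\times\mathbb{P}^{1,\mathrm{an}}_k\to\mathbb{P}^{1,\mathrm{an}}_k$ whose image $\Upsilon=\psi(e,\mathbb{P}^{1,\mathrm{an}}_k)$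 is homeomorphic to a finite simplicial complex, such that $f(x)=f(\psi(e,x))$ for every $x$ and $f|_\Upsilon$ has piecewise linear logarithm. **(B)** There are a generalised real interval $[i,e]$, a deformation retraction $\psi:[i,e]\times\mathbb{P}^{1,\mathrm{an}}_k\to\mathbb{P}^{1,\mathrm{an}}_k$ whose image $\Upsilon=\psi(e,\mathbb{P}^{1,\mathrm{an}}_k)$ is homeomorphic to a finite simplicial complex, and a function $M:\Upsilon\to[0,1]$, not identically zero and with piecewise linear logarithm, such that for all $\gamma\in\Upsilon$, all $x$ with $\psi(e,x)=\gamma$, and all $L/k$ and $x_L$ as above: (a) if $M(\gamma)>0$, then $B(x_L,M(\gamma))$ splits into balls; (b) if $0<r\le 1$ and $B(x_L,r)$ splits into balls, then $r\le M(\gamma)$. Then (A) and (B) are equivalent. More precisely, they hold with the same deformation retractions: if $f$ and $\psi$ are as in (A), then there is a function $M:\Upsilon\to[0,1]$ with $M(\psi(e,x))=f(x)$ for all $x$, and $\psi,M$ are as in (B); conversely, if $\psi,M$ are as in (B), then $f(x):=M(\psi(e,x))$ is the function in (A), and $f,\psi$ are as in (A). -/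

import Mathlib

universe u

noncomputable section

namespace P1An

/-! ## The Berkovich projective line in homogeneous coordinates

The coordinates `T₁, T₂` are `MvPolynomial.X 0, MvPolynomial.X 1`; the affine coordinate is
`T = T₁ / T₂`, and `∞ = [1 : 0]`. -/

/-- A multiplicative non-Archimedean seminorm on `K[T₁, T₂]` that restricts to the absolute value
of `K` and does not vanish at both `T₁` and `T₂`. -/
structure HomSeminorm (K : Type u) [NormedField K] where
  val : MulRingSeminorm (MvPolynomial (Fin 2) K)
  add_le_max' : ∀ f g, val (f + g) ≤ max (val f) (val g)
  val_C : ∀ a : K, val (MvPolynomial.C a) = ‖a‖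
  exists_ne_zero : ∃ i, val (MvPolynomial.X i) ≠ 0

section Space

variable (K : Type u) [NormedField K]

/-- The weakest topology for which all evaluations `s ↦ |f(s)|` are continuous. -/
instance instTopologicalSpaceHomSeminorm : TopologicalSpace (HomSeminorm K) :=
  TopologicalSpace.induced (fun s f => s.val f) inferInstance

/-- `s ∼ t` if for some `c > 0` one has `|f(s)| = c ^ deg f * |f(t)|` for all homogeneous `f`. -/
def homSetoid : Setoid (HomSeminorm K) where
  r s t := ∃ c : ℝ, 0 < c ∧ ∀ (n : ℕ) (f : MvPolynomial (Fin 2) K), f.IsHomogeneous n →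
    s.val f = c ^ n * t.val f
  iseqv :=
    { refl := fun s => ⟨1, one_pos, fun n f _ => by simp⟩
      symm := by
        rintro s t ⟨c, hc, h⟩
        refine ⟨c⁻¹, inv_pos.mpr hc, fun n f hf => ?_⟩
        rw [h n f hf, ← mul_assoc, ← mul_pow, inv_mul_cancel₀ hc.ne', one_pow, one_mul]
      trans := by
        rintro s t w ⟨c, hc, h⟩ ⟨d, hd, h'⟩
        refine ⟨c * d, mul_pos hc hd, fun n f hf => ?_⟩
        rw [h n f hf, h' n f hf, mul_pow, mul_assoc] }

/-- The Berkovich analytification of the projective line over `K`. -/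
def Space : Type u := Quotient (homSetoid K)

/-- The quotient topology. -/
instance instTopologicalSpaceSpace : TopologicalSpace (Space K) :=
  inferInstanceAs (TopologicalSpace (Quotient (homSetoid K)))

variable {K}

/-- The point of the projective line defined by a seminorm. -/
def mk (s : HomSeminorm K) : Space K := Quotient.mk (homSetoid K) s

/-- The linear form `T₁ - a T₂`. -/
def linForm (a : K) : MvPolynomial (Fin 2) K :=
  MvPolynomial.X 0 - MvPolynomial.C a * MvPolynomial.X 1

/-- The disc `{|T - a| < r}` around a point `a` of the affine line. -/
def affineDisc (a : K) (r : ℝ) : Set (Space K) :=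
  mk '' {s | s.val (linForm a) < r * s.val (MvPolynomial.X 1)}

/-- The disc `{|T - a| > r}`, which contains `∞`. -/
def coDisc (a : K) (r : ℝ) : Set (Space K) :=
  mk '' {s | r * s.val (MvPolynomial.X 1) < s.val (linForm a)}

/-- Berkovich open balls of the projective line: the open discs of the affine line, and the
complements of its closed discs. -/
def IsOpenBall (U : Set (Space K)) : Prop :=
  ∃ (a : K) (r : ℝ), 0 < r ∧ (U = affineDisc a r ∨ U = coDisc a r)

/-- The Berkovich open ball of radius `r` around the `K`-point `p`: it is `{|T - a| < r}` if
`p = [a : 1]`, and `{|1 / T| < r}` if `p = ∞ = [1 : 0]`. -/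
def ball (p : Projectivization K (Fin 2 → K)) (r : ℝ) : Set (Space K) :=
  open Classical in
  if p.rep 1 = 0 then mk '' {s | s.val (MvPolynomial.X 1) < r * s.val (MvPolynomial.X 0)}
  else affineDisc (p.rep 0 / p.rep 1) r

end Space

/-! ## Points with values in extensions -/

section Points

variable (k : Type u) [NormedField k] {L : Type u} [NormedField L] [NormedAlgebra k L]
  [IsUltrametricDist L]

/-- The seminorm `f ↦ |f(v)|` on `k[T₁, T₂]` for a non-zero vector `v` over an extension of `k`. -/
def evalSeminorm (v : Fin 2 → L) (hv : v ≠ 0) : HomSeminorm k where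
  val :=
    { toFun := fun f => ‖MvPolynomial.aeval v f‖
      map_zero' := by simp
      add_le' := fun f g => by rw [map_add]; exact norm_add_le _ _
      neg' := fun f => by rw [map_neg, norm_neg]
      map_one' := by simp
      map_mul' := fun f g => by rw [map_mul, norm_mul] }
  add_le_max' f g := by
    change ‖MvPolynomial.aeval v (f + g)‖ ≤ max ‖MvPolynomial.aeval v f‖ ‖MvPolynomial.aeval v g‖
    rw [map_add]; exact IsUltrametricDist.norm_add_le_max _ _
  val_C a := by
    change ‖MvPolynomial.aeval v (MvPolynomial.C a)‖ = ‖a‖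
    rw [MvPolynomial.aeval_C, norm_algebraMap']
  exists_ne_zero := by
    obtain ⟨i, hi⟩ := Function.ne_iff.mp hv
    refine ⟨i, ?_⟩
    change ‖MvPolynomial.aeval v (MvPolynomial.X i)‖ ≠ 0
    rw [MvPolynomial.aeval_X]
    simpa using hi

/-- The point of the Berkovich line over `k` that underlies an `L`-point `p` of the projective
line. So `x` has values in `L`, with associated `L`-point `x_L = p`, when
`underlying k p = x`. -/
def underlying (p : Projectivization L (Fin 2 → L)) : Space k :=
  mk (evalSeminorm k p.rep p.rep_nonzero)

end Points

/-! ## Finite endomorphisms of the projective line -/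

/-- A finite (that is, non-constant) morphism from the projective line over `K` to itself, in
homogeneous coordinates: two forms of the same degree `≥ 1` without a common zero on the
projective line. -/
structure FiniteMorphism (K : Type u) [Field K] where
  deg : ℕ
  deg_pos : 0 < deg
  form : Fin 2 → MvPolynomial (Fin 2) K
  homogeneous : ∀ i, (form i).IsHomogeneous deg
  no_common_zero : ∀ i, MvPolynomial.X i ∈ (Ideal.span (Set.range form)).radical

namespace FiniteMorphism

/-- The base change `φ_L`. -/
def baseChange {k : Type u} [Field k] (φ : FiniteMorphism k) (L : Type u) [Field L]
    [Algebra k L] : FiniteMorphism L where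
  deg := φ.deg
  deg_pos := φ.deg_pos
  form i := MvPolynomial.map (algebraMap k L) (φ.form i)
  homogeneous i := (φ.homogeneous i).map _
  no_common_zero i := by
    obtain ⟨n, hn⟩ := φ.no_common_zero i
    refine ⟨n, ?_⟩
    have h := Ideal.mem_map_of_mem (MvPolynomial.map (algebraMap k L)) hn
    rw [Ideal.map_span, ← Set.range_comp, map_pow, MvPolynomial.map_X] at h
    exact h

variable {K : Type u} [NormedField K] (φ : FiniteMorphism K)

/-- Composition of a seminorm with the substitution `T₁, T₂ ↦ F₁, F₂`. -/
def mapSeminorm (s : HomSeminorm K) : HomSeminorm K where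
  val :=
    { toFun := fun f => s.val (MvPolynomial.aeval φ.form f)
      map_zero' := by simp
      add_le' := fun f g => by rw [map_add]; exact map_add_le_add _ _ _
      neg' := fun f => by rw [map_neg]; exact map_neg_eq_map _ _
      map_one' := by simp
      map_mul' := fun f g => by rw [map_mul]; exact map_mul _ _ _ }
  add_le_max' f g := by
    change s.val (MvPolynomial.aeval φ.form (f + g)) ≤
      max (s.val (MvPolynomial.aeval φ.form f)) (s.val (MvPolynomial.aeval φ.form g))
    rw [map_add]; exact s.add_le_max' _ _
  val_C a := by
    change s.val (MvPolynomial.aeval φ.form (MvPolynomial.C a)) = ‖a‖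
    rw [MvPolynomial.aeval_C]; exact s.val_C a
  exists_ne_zero := by
    by_contra! h
    have h0 : ∀ i, s.val (φ.form i) = 0 := fun i => by
      have := h i
      change s.val (MvPolynomial.aeval φ.form (MvPolynomial.X i)) = 0 at this
      rwa [MvPolynomial.aeval_X] at this
    have hI : ∀ f ∈ Ideal.span (Set.range φ.form), s.val f = 0 := by
      intro f hf
      induction hf using Submodule.span_induction with
      | mem x hx => obtain ⟨i, rfl⟩ := hx; exact h0 i
      | zero => exact map_zero _
      | add x y _ _ hx hy =>
        refine le_antisymm ((s.add_le_max' x y).trans ?_) (apply_nonneg _ _)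
        simp [hx, hy]
      | smul a x _ hx => rw [smul_eq_mul, map_mul, hx, mul_zero]
    obtain ⟨i, hi⟩ := s.exists_ne_zero
    obtain ⟨n, hn⟩ := φ.no_common_zero i
    have := hI _ hn
    rw [map_pow] at this
    exact hi (eq_zero_of_pow_eq_zero this)

/-- The analytification `φ^an`. -/
def an : Space K → Space K :=
  Quotient.map' (s₁ := homSetoid K) (s₂ := homSetoid K) φ.mapSeminorm (by
    rintro s t ⟨c, hc, h⟩
    refine ⟨c ^ φ.deg, pow_pos hc _, fun n f hf => ?_⟩
    change s.val (MvPolynomial.aeval φ.form f) =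
      (c ^ φ.deg) ^ n * t.val (MvPolynomial.aeval φ.form f)
    rw [← pow_mul]
    refine h _ _ ?_
    exact hf.aeval φ.form φ.homogeneous)

end FiniteMorphism

/-! ## Splitting of balls, and the radius function -/

/-- `Φ` restricts to a homeomorphism from `U` onto `B`. -/
def IsHomeoVia {X : Type u} [TopologicalSpace X] (Φ : X → X) (U B : Set X) : Prop :=
  ∃ h : U ≃ₜ B, ∀ u : U, (h u : X) = Φ u

/-- The preimage of `B` is the disjoint union of open sets that satisfy `P`, each mapped
homeomorphically onto `B`. -/
def SplitsWith {X : Type u} [TopologicalSpace X] (P : Set X → Prop) (Φ : X → X) (B : Set X) :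
    Prop :=
  ∃ 𝒰 : Set (Set X), (∀ U ∈ 𝒰, IsOpen U ∧ P U ∧ IsHomeoVia Φ U B) ∧
    𝒰.PairwiseDisjoint id ∧ ⋃₀ 𝒰 = Φ ⁻¹' B

/-- The preimage of `B` is the disjoint union of homeomorphic copies of `B`. -/
def Splits {L : Type u} [NormedField L] (φ : FiniteMorphism L) (B : Set (Space L)) : Prop :=
  SplitsWith (fun _ => True) φ.an B

/-- The preimage of `B` is the disjoint union of Berkovich open balls, each homeomorphic to `B`. -/
def SplitsIntoBalls {L : Type u} [NormedField L] (φ : FiniteMorphism L) (B : Set (Space L)) :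
    Prop :=
  SplitsWith IsOpenBall φ.an B

/-- `v` is the minimum of `1` and the radius of the largest Berkovich open ball around `p` that
splits; it is `0` if no ball splits and `1` if there are splitting balls of arbitrarily large
radius. -/
def IsCappedRadius {L : Type u} [NormedField L] (φ : FiniteMorphism L)
    (p : Projectivization L (Fin 2 → L)) (v : ℝ) : Prop :=
  let S : Set ℝ := {r | 0 < r ∧ Splits φ (ball p r)}
  (S = ∅ ∧ v = 0) ∨ (∃ R, IsGreatest S R ∧ v = min 1 R) ∨ (¬ BddAbove S ∧ v = 1)

open scoped NNReal

/-- `f` is the (well defined) function that sends `x` to the minimum of `1` and the radius of the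
largest splitting ball around `x_L`, for every complete algebraically closed `L / k` over which
`x` has a point `x_L`. -/
def IsRadiusFunction {k : Type u} [NormedField k] (φ : FiniteMorphism k) (f : Space k → ℝ≥0) :
    Prop :=
  (∀ x, f x ≤ 1) ∧
  ∀ (L : Type u) [NormedField L] [NormedAlgebra k L] [IsUltrametricDist L] [CompleteSpace L]
    [IsAlgClosed L] (x : Space k) (p : Projectivization L (Fin 2 → L)), underlying k p = x →
    IsCappedRadius (φ.baseChange L) p (f x)

/-! ## Generalised intervals, deformation retractions, finite complexes -/

/-- A linear order obtained by glueing finitely many closed intervals of `ℝ ∪ {∞}`, each with its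
usual or with the opposite orientation, end to end. -/
inductive IsGeneralizedInterval : (I : Type) → [LinearOrder I] → Prop
  | segment {I : Type} [LinearOrder I] (a b : WithTop ℝ) (hab : a ≤ b) (e : I ≃o Set.Icc a b) :
      IsGeneralizedInterval I
  | reversed {I : Type} [LinearOrder I] (a b : WithTop ℝ) (hab : a ≤ b)
      (e : I ≃o (Set.Icc a b)ᵒᵈ) : IsGeneralizedInterval I
  | concat {I : Type} [LinearOrder I] (c : I) (h₁ : IsGeneralizedInterval (Set.Iic c))
      (h₂ : IsGeneralizedInterval (Set.Ici c)) : IsGeneralizedInterval I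

/-- A generalised real interval `[i, e]`, with `i = ⊥` and `e = ⊤`, and its order topology. -/
structure GeneralizedInterval where
  carrier : Type
  [linearOrder : LinearOrder carrier]
  [boundedOrder : BoundedOrder carrier]
  [topology : TopologicalSpace carrier]
  [orderTopology : OrderTopology carrier]
  isGeneralizedInterval : IsGeneralizedInterval carrier

attribute [instance] GeneralizedInterval.linearOrder GeneralizedInterval.boundedOrder
  GeneralizedInterval.topology GeneralizedInterval.orderTopology

section Retraction

variable {X : Type u}

/-- The final map `ψ(e, _)`. -/
def finalMap {I : GeneralizedInterval} (ψ : I.carrier × X → X) (x : X) : X := ψ (⊤, x)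

/-- The image `ψ(e, X)`. -/
def image {I : GeneralizedInterval} (ψ : I.carrier × X → X) : Set X := Set.range (finalMap ψ)

/-- The final map as a map onto the image. -/
def toImage {I : GeneralizedInterval} (ψ : I.carrier × X → X) (x : X) : image ψ :=
  ⟨finalMap ψ x, x, rfl⟩

/-- `ψ` is a deformation retraction of `X` onto its final image: it is continuous, starts at the
identity and fixes the final image pointwise at all times. -/
structure IsDeformationRetraction {I : GeneralizedInterval} [TopologicalSpace X]
    (ψ : I.carrier × X → X) : Prop where
  continuous : Continuous ψ
  start : ∀ x, ψ (⊥, x) = x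
  fixes_image : ∀ t, ∀ y ∈ image ψ, ψ (t, y) = y

end Retraction

/-- `Υ` is homeomorphic to (the space of) a finite simplicial complex. -/
def IsFiniteSimplicialComplex {X : Type u} [TopologicalSpace X] (Υ : Set X) : Prop :=
  ∃ (n : ℕ) (K : Geometry.SimplicialComplex ℝ (EuclideanSpace ℝ (Fin n))),
    K.faces.Finite ∧ Nonempty (Υ ≃ₜ K.space)

/-! ## Piecewise linear functions on subgraphs -/

section PiecewiseLinear

variable {k : Type u} [NormedField k]

/-- The order `|f(x)| ≤ |f(y)|` for all polynomials `f` in the affine coordinate `T`, with `∞` as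
the largest point; a polynomial of degree `≤ n` in `T` is a form of degree `n` divided by
`T₂ ^ n`. -/
def Below (x y : Space k) : Prop :=
  ∃ s t : HomSeminorm k, mk s = x ∧ mk t = y ∧
    ∀ (n : ℕ) (f : MvPolynomial (Fin 2) k), f.IsHomogeneous n →
      s.val f * t.val (MvPolynomial.X 1) ^ n ≤ t.val f * s.val (MvPolynomial.X 1) ^ n

/-- The open segment between `x` and `y`, where `x` lies below `y`. -/
def openSegment (x y : Space k) : Set (Space k) :=
  {z | Below x z ∧ Below z y ∧ z ≠ x ∧ z ≠ y}

/-- The radius `inf_a |T - a|` of a point other than `∞`. Its logarithm is the linear coordinate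
on segments of the Berkovich line. -/
def diam (x : Space k) : ℝ :=
  ⨅ a : k, (Quotient.out x : HomSeminorm k).val (linForm a) /
    (Quotient.out x : HomSeminorm k).val (MvPolynomial.X 1)

/-- `log_c g` is piecewise linear on the graph `Υ`: there is a decomposition of `Υ` into finitely
many vertices and open segments between vertices such that `log_c g` is on each segment an affine
function of `log_c` of the radius, or identically infinite (that is, `g = 0` there). The value at
a vertex is arbitrary. -/
def IsLogPiecewiseLinear (c : ℝ) (Υ : Set (Space k)) (g : Υ → ℝ≥0) : Prop :=
  ∃ (V : Set (Space k)) (E : Set (Space k × Space k)), V.Finite ∧ E.Finite ∧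
    (∀ e ∈ E, e.1 ∈ V ∧ e.2 ∈ V ∧ Below e.1 e.2 ∧ e.1 ≠ e.2) ∧
    Υ = V ∪ ⋃ e ∈ E, openSegment e.1 e.2 ∧
    ∀ e ∈ E,
      (∀ z : Υ, (z : Space k) ∈ openSegment e.1 e.2 → g z = 0) ∨
      ∃ α β : ℝ, ∀ z : Υ, (z : Space k) ∈ openSegment e.1 e.2 →
        0 < g z ∧ Real.logb c (g z) = α * Real.logb c (diam (z : Space k)) + β

end PiecewiseLinear

/-! ## The two theorems -/

section Theorems

variable {k : Type u} [NormedField k]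

/-- The radius function `f` of `φ` and the deformation retraction `ψ` are as asserted in the
theorem on the radius function. -/
structure RadiusData (c : ℝ) (φ : FiniteMorphism k) (f : Space k → ℝ≥0)
    {I : GeneralizedInterval} (ψ : I.carrier × Space k → Space k) : Prop where
  isRadiusFunction : IsRadiusFunction φ f
  not_zero : ∃ x, f x ≠ 0
  isDeformationRetraction : IsDeformationRetraction ψ
  finite_complex : IsFiniteSimplicialComplex (image ψ)
  constant_on_fibres : ∀ x, f x = f (finalMap ψ x)
  piecewise_linear : IsLogPiecewiseLinear c (image ψ) (fun γ => f γ)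

/-- The deformation retraction `ψ` and the function `M` on its image are as asserted in the theorem
on the skeleton. -/
structure SkeletonData (c : ℝ) (φ : FiniteMorphism k) {I : GeneralizedInterval}
    (ψ : I.carrier × Space k → Space k) (M : image ψ → Set.Icc (0 : ℝ≥0) 1) : Prop where
  isDeformationRetraction : IsDeformationRetraction ψ
  finite_complex : IsFiniteSimplicialComplex (image ψ)
  not_zero : ∃ γ, (M γ : ℝ≥0) ≠ 0
  piecewise_linear : IsLogPiecewiseLinear c (image ψ) (fun γ => M γ)
  splits : ∀ γ : image ψ, 0 < (M γ : ℝ≥0) → ∀ x : Space k, finalMap ψ x = γ →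
    ∀ (L : Type u) [NormedField L] [NormedAlgebra k L] [IsUltrametricDist L] [CompleteSpace L]
      [IsAlgClosed L] (p : Projectivization L (Fin 2 → L)), underlying k p = x →
      SplitsIntoBalls (φ.baseChange L) (ball p (M γ : ℝ≥0))
  maximal : ∀ γ : image ψ, ∀ x : Space k, finalMap ψ x = γ →
    ∀ (L : Type u) [NormedField L] [NormedAlgebra k L] [IsUltrametricDist L] [CompleteSpace L]
      [IsAlgClosed L] (p : Projectivization L (Fin 2 → L)), underlying k p = x →
      ∀ r : ℝ, 0 < r → r ≤ 1 → SplitsIntoBalls (φ.baseChange L) (ball p r) → r ≤ (M γ : ℝ≥0)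

/-- The theorem on the radius function, for `φ`: the radius function is well defined and not
identically zero, and it is constant on the fibres of a deformation retraction onto a finite
simplicial complex, on which its logarithm is piecewise linear. -/
def RadiusTheorem (c : ℝ) (φ : FiniteMorphism k) : Prop :=
  ∃ f : Space k → ℝ≥0, ∃ (I : GeneralizedInterval) (ψ : I.carrier × Space k → Space k),
    RadiusData c φ f ψ

/-- The theorem on the skeleton, for `φ`. -/
def SkeletonTheorem (c : ℝ) (φ : FiniteMorphism k) : Prop :=
  ∃ (I : GeneralizedInterval) (ψ : I.carrier × Space k → Space k)
    (M : image ψ → Set.Icc (0 : ℝ≥0) 1), SkeletonData c φ ψ M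

end Theorems

end P1An

end

/-! The two statements differ in two respects: whether the sheets over a splitting ball have to be
balls, and whether a largest splitting radius exists. Two facts remove these differences, and then
both numbers attached to `x` are the largest `r ≤ 1` for which the ball splits, or `0` if there is
none.

The splitting radii at `x_L` form a down-closed set (`Splits.ball_of_le`) that contains its supremum
when it is nonempty and bounded: sheets over an increasing union of connected open sets are unions
of sheets (`splitsWith_iUnion`, `splits_ball_of_forall_lt`).

Every sheet `U` over a splitting open ball `B` is itself an open ball
(`FiniteMorphism.isOpenBall_of_isHomeoVia`). The argument is topological. Exhaust `B` by closed sets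
with a single boundary point and connected complement in `B`. Their lifts to `U` are closed with a
single boundary point `ζ`, and only one direction at `ζ` leads out of them, so their complements are
open balls (`exists_direction`, `isOpenBall_compl`). Hence `U` is an increasing union of complements
of open balls. It omits two classical points, because `B` does and the morphism is surjective on
classical points, so the union is an open ball (`isOpenBall_iUnion`) rather than an affine line or
the complement of a point.

The topology of the line is read off from the functions `a ↦ |T - a|`. Over an algebraically closed
field forms are products of linear forms, so these functions separate points; conversely every
ultrametric root function comes from a point. Raising a root function to `max d t` yields the paths
that give connectedness. -/

noncomputable section

namespace P1An

open Polynomial Topology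
open scoped ENNReal

/-! ### Seminorms attached to ultrametric root functions -/

section RootFunctions

variable {L : Type u} [NormedField L]

/-- A function `d` on `L` that behaves like the distance to a point of an ultrametric extension
of `L`. -/
structure IsRootFunction (d : L → ℝ) : Prop where
  le_max : ∀ a b, d a ≤ max (d b) ‖a - b‖
  norm_le_max : ∀ a b, ‖a - b‖ ≤ max (d a) (d b)

namespace IsRootFunction

variable {d : L → ℝ}

theorem nonneg (hd : IsRootFunction d) (a : L) : 0 ≤ d a := by
  simpa using hd.norm_le_max a a

/-- Letting `t` grow moves the point upwards towards Gauss points; these are the paths behind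
connectedness. -/
theorem max_const (hd : IsRootFunction d) (t : ℝ) :
    IsRootFunction fun a => max (d a) t where
  le_max a b := by
    have := hd.le_max a b
    grind
  norm_le_max a b := by
    have := hd.norm_le_max a b
    grind

/-- On the set where it is not below its value at `b`, a root function is the supremum of the
distance to `b` and a constant. -/
theorem eq_max_of_le (hd : IsRootFunction d) {a b : L} (h : d b ≤ d a) :
    d a = max ‖a - b‖ (d b) := by
  have h1 := hd.le_max a b
  have h2 := hd.norm_le_max a b
  grind

end IsRootFunction

theorem isRootFunction_norm_sub [IsUltrametricDist L] (b : L) :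
    IsRootFunction fun a => ‖a - b‖ where
  le_max a c := by
    have := IsUltrametricDist.norm_add_le_max (c - b) (a - c)
    rwa [show c - b + (a - c) = a - b by ring] at this
  norm_le_max a c := by
    have := IsUltrametricDist.norm_add_le_max (a - b) (b - c)
    rwa [show a - b + (b - c) = a - c by ring, norm_sub_rev b c] at this

/-- The value at `g` of the seminorm for which `T - a` has value `d a`. -/
def rootNorm (d : L → ℝ) (g : L[X]) : ℝ := ‖g.leadingCoeff‖ * (g.roots.map d).prod

theorem rootNorm_zero (d : L → ℝ) : rootNorm d 0 = 0 := by simp [rootNorm]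

theorem rootNorm_C (d : L → ℝ) (c : L) : rootNorm d (C c) = ‖c‖ := by simp [rootNorm]

theorem rootNorm_neg (d : L → ℝ) (g : L[X]) : rootNorm d (-g) = rootNorm d g := by
  simp [rootNorm, roots_neg]

theorem rootNorm_X_sub_C (d : L → ℝ) (a : L) : rootNorm d (X - C a) = d a := by
  simp [rootNorm]

theorem rootNorm_mul (d : L → ℝ) (g h : L[X]) :
    rootNorm d (g * h) = rootNorm d g * rootNorm d h := by
  by_cases hgh : g * h = 0
  · rcases mul_eq_zero.mp hgh with rfl | rfl <;> simp [rootNorm]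
  · simp only [rootNorm, leadingCoeff_mul, norm_mul, roots_mul hgh, Multiset.map_add,
      Multiset.prod_add]
    ring

theorem rootNorm_nonneg {d : L → ℝ} (hd : IsRootFunction d) (g : L[X]) : 0 ≤ rootNorm d g :=
  mul_nonneg (norm_nonneg _) (Multiset.prod_nonneg fun x hx => by
    obtain ⟨a, -, rfl⟩ := Multiset.mem_map.mp hx
    exact hd.nonneg a)

theorem gaussNorm_X_add_C [IsUltrametricDist L] {t : ℝ} (ht : 0 ≤ t) (e : L) :
    (X + C e).gaussNorm (NormedField.toAbsoluteValue L) t = max ‖e‖ t := by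
  have hna : IsNonarchimedean (NormedField.toAbsoluteValue L) :=
    IsUltrametricDist.isNonarchimedean_norm
  refine le_antisymm ?_ (max_le ?_ ?_)
  · refine (isNonarchimedean_gaussNorm _ hna ht _ _).trans ?_
    rw [gaussNorm_C, ← monomial_one_one_eq_X, gaussNorm_monomial]
    simp [NormedField.toAbsoluteValue, max_comm]
  · refine le_trans (le_of_eq ?_) (le_gaussNorm (NormedField.toAbsoluteValue L) (X + C e) ht 0)
    simp [NormedField.toAbsoluteValue, coeff_add]
  · refine le_trans (le_of_eq ?_) (le_gaussNorm (NormedField.toAbsoluteValue L) (X + C e) ht 1)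
    simp [NormedField.toAbsoluteValue, coeff_add]

/-- For root functions of Gauss type, `rootNorm` is a Gauss norm. -/
theorem rootNorm_eq_gaussNorm [IsUltrametricDist L] [IsAlgClosed L] {d : L → ℝ} {b : L} {t : ℝ}
    (ht : 0 ≤ t) (g : L[X]) (hg : ∀ a ∈ g.roots, d a = max ‖a - b‖ t) :
    rootNorm d g = (taylor b g).gaussNorm (NormedField.toAbsoluteValue L) t := by
  set v := NormedField.toAbsoluteValue L with hv
  have hna : IsNonarchimedean v := IsUltrametricDist.isNonarchimedean_norm
  have hmul : ∀ p q : L[X], (p * q).gaussNorm v t = p.gaussNorm v t * q.gaussNorm v t := by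
    intro p q
    -- For `t = 0` the Gauss norm is the norm of the constant coefficient; multiplicativity of Gauss
    -- norms is applied only for `t > 0`.
    rcases ht.eq_or_lt with rfl | ht
    · simp [mul_coeff_zero]
    · exact gaussNorm_mul hna ht p q
  have hprod : ∀ m : Multiset L, (∀ a ∈ m, d a = max ‖a - b‖ t) →
      (taylor b (m.map fun a => X - C a).prod).gaussNorm v t = (m.map d).prod := by
    intro m
    induction m using Multiset.induction_on with
    | empty =>
      intro _
      rw [Multiset.map_zero, Multiset.prod_zero, taylor_one, gaussNorm_C, Multiset.map_zero,
        Multiset.prod_zero, map_one]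
    | cons a m ih =>
      intro h
      rw [Multiset.map_cons, Multiset.prod_cons, taylor_mul, hmul,
        ih fun x hx => h x (Multiset.mem_cons_of_mem hx), Multiset.map_cons, Multiset.prod_cons,
        h a (Multiset.mem_cons_self a m), map_sub, taylor_X, taylor_C, add_sub_assoc, ← C_sub,
        gaussNorm_X_add_C ht, norm_sub_rev]
  conv_rhs => rw [(IsAlgClosed.splits g).eq_prod_roots]
  rw [taylor_mul, hmul, hprod _ hg, taylor_C, gaussNorm_C]
  rfl

/-- The roots of a sum are unrelated to those of the summands, so the inequality is taken from a
Gauss norm. If `b` minimises `d` on the finitely many roots involved, then `d` equals `max ‖a - b‖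
(d b)` there, and all three values are Gauss norms with the same centre and radius. -/
theorem rootNorm_add_le [IsUltrametricDist L] [IsAlgClosed L] {d : L → ℝ}
    (hd : IsRootFunction d) (g h : L[X]) :
    rootNorm d (g + h) ≤ max (rootNorm d g) (rootNorm d h) := by
  classical
  have hna : IsNonarchimedean (NormedField.toAbsoluteValue L) :=
    IsUltrametricDist.isNonarchimedean_norm
  -- The element `0` only makes the finite set nonempty.
  set F : Finset L := insert 0 (g.roots + h.roots + (g + h).roots).toFinset with hF
  obtain ⟨b, -, hb⟩ := F.exists_min_image d ⟨0, Finset.mem_insert_self _ _⟩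
  have key : ∀ q : L[X], q.roots.toFinset ⊆ F →
      rootNorm d q = (taylor b q).gaussNorm (NormedField.toAbsoluteValue L) (d b) :=
    fun q hq => rootNorm_eq_gaussNorm (hd.nonneg b) q fun a ha =>
      hd.eq_max_of_le (hb a (hq (Multiset.mem_toFinset.mpr ha)))
  have hsub : ∀ a, (a ∈ g.roots ∨ a ∈ h.roots ∨ a ∈ (g + h).roots) → a ∈ F := by
    intro a ha
    simp only [hF, Finset.mem_insert, Multiset.mem_toFinset, Multiset.mem_add]
    tauto
  rw [key g fun a ha => hsub a (Or.inl (Multiset.mem_toFinset.mp ha)),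
    key h fun a ha => hsub a (Or.inr (Or.inl (Multiset.mem_toFinset.mp ha))),
    key (g + h) fun a ha => hsub a (Or.inr (Or.inr (Multiset.mem_toFinset.mp ha))), map_add]
  exact isNonarchimedean_gaussNorm _ hna (hd.nonneg b) _ _

/-- The seminorm on forms determined by a root function, normalised by `|T₂| = 1`. -/
def ofRootFunction [IsUltrametricDist L] [IsAlgClosed L] (d : L → ℝ) (hd : IsRootFunction d) :
    HomSeminorm L where
  val :=
    { toFun := fun f => rootNorm d (MvPolynomial.aeval ![X, 1] f)
      map_zero' := by simp [rootNorm_zero]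
      add_le' := fun f g => by
        rw [map_add]
        exact (rootNorm_add_le hd _ _).trans
          (max_le_add_of_nonneg (rootNorm_nonneg hd _) (rootNorm_nonneg hd _))
      neg' := fun f => by rw [map_neg, rootNorm_neg]
      map_one' := by simp [rootNorm]
      map_mul' := fun f g => by rw [map_mul, rootNorm_mul] }
  add_le_max' f g := by
    change rootNorm d (MvPolynomial.aeval ![X, 1] (f + g)) ≤ _
    rw [map_add]
    exact rootNorm_add_le hd _ _
  val_C a := by
    change rootNorm d (MvPolynomial.aeval ![X, 1] (MvPolynomial.C a)) = _
    rw [MvPolynomial.aeval_C]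
    exact rootNorm_C d a
  exists_ne_zero := by
    refine ⟨1, ?_⟩
    change rootNorm d (MvPolynomial.aeval ![X, 1] (MvPolynomial.X 1)) ≠ 0
    simp [rootNorm]

variable [IsUltrametricDist L] [IsAlgClosed L]

theorem ofRootFunction_linForm (d : L → ℝ) (hd : IsRootFunction d) (a : L) :
    (ofRootFunction d hd).val (linForm a) = d a := by
  change rootNorm d (MvPolynomial.aeval ![X, 1] (linForm a)) = d a
  rw [← rootNorm_X_sub_C d a]
  simp [linForm]

theorem ofRootFunction_X_one (d : L → ℝ) (hd : IsRootFunction d) :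
    (ofRootFunction d hd).val (MvPolynomial.X 1) = 1 := by
  change rootNorm d (MvPolynomial.aeval ![X, 1] (MvPolynomial.X 1)) = 1
  simp [rootNorm]

end RootFunctions

/-! ### The functions `|T - a|` -/

section AbsSub

variable {L : Type u} [NormedField L]

namespace HomSeminorm

theorem val_nonneg (s : HomSeminorm L) (f : MvPolynomial (Fin 2) L) : 0 ≤ s.val f :=
  apply_nonneg _ _

theorem val_linForm_le (s : HomSeminorm L) (a b : L) :
    s.val (linForm a) ≤ max (s.val (linForm b)) (‖a - b‖ * s.val (MvPolynomial.X 1)) := by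
  have := s.add_le_max' (linForm b) (-(MvPolynomial.C (a - b) * MvPolynomial.X 1))
  rwa [map_neg_eq_map, map_mul, s.val_C, show linForm b +
    -(MvPolynomial.C (a - b) * MvPolynomial.X 1) = linForm a by
      simp only [linForm, map_sub]; ring] at this

theorem norm_sub_mul_le (s : HomSeminorm L) (a b : L) :
    ‖a - b‖ * s.val (MvPolynomial.X 1) ≤ max (s.val (linForm a)) (s.val (linForm b)) := by
  have := s.add_le_max' (-linForm a) (linForm b)
  rwa [map_neg_eq_map, show -linForm a + linForm b =
    MvPolynomial.C (a - b) * MvPolynomial.X 1 by simp only [linForm, map_sub]; ring,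
    map_mul, s.val_C] at this

theorem val_linForm_ne_zero (s : HomSeminorm L) (h : s.val (MvPolynomial.X 1) = 0) (a : L) :
    s.val (linForm a) ≠ 0 := by
  intro h'
  obtain ⟨i, hi⟩ := s.exists_ne_zero
  fin_cases i
  · refine hi (le_antisymm ?_ (s.val_nonneg _))
    have := s.add_le_max' (linForm a) (MvPolynomial.C a * MvPolynomial.X 1)
    rw [map_mul, h, h', mul_zero, max_self] at this
    simpa [linForm] using this
  · exact hi h

theorem isRootFunction (s : HomSeminorm L)
    (hs : s.val (MvPolynomial.X 1) ≠ 0) :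
    IsRootFunction fun a => s.val (linForm a) / s.val (MvPolynomial.X 1) := by
  have hpos := (s.val_nonneg _).lt_of_ne' hs
  refine ⟨fun a b => ?_, fun a b => ?_⟩
  · rw [div_le_iff₀ hpos, max_mul_of_nonneg _ _ hpos.le, div_mul_cancel₀ _ hs]
    exact s.val_linForm_le a b
  · rw [← mul_le_mul_iff_left₀ hpos, max_mul_of_nonneg _ _ hpos.le, div_mul_cancel₀ _ hs,
      div_mul_cancel₀ _ hs]
    exact s.norm_sub_mul_le a b

end HomSeminorm

/-! ### Factorisation of binary forms -/

theorem natDegree_aeval_X_one_le {n : ℕ} {f : MvPolynomial (Fin 2) L} (hf : f.IsHomogeneous n) :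
    (MvPolynomial.aeval ![(X : L[X]), 1] f).natDegree ≤ n := by
  rw [f.as_sum, map_sum]
  refine natDegree_sum_le_of_forall_le _ _ fun m hm => ?_
  have hmn : m 0 + m 1 = n := by
    have := hf (MvPolynomial.mem_support_iff.mp hm)
    simpa [Finsupp.weight_apply, Finsupp.sum_fintype, Fin.sum_univ_two] using this
  rw [MvPolynomial.aeval_monomial, Finsupp.prod_fintype _ _ (by simp), Fin.prod_univ_two]
  simp only [Matrix.cons_val_zero, Matrix.cons_val_one, one_pow, mul_one, ← C_eq_algebraMap]
  exact (natDegree_C_mul_X_pow_le _ _).trans (by omega)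

theorem isHomogeneous_linForm (a : L) : (linForm a).IsHomogeneous 1 := by
  refine (MvPolynomial.isHomogeneous_X _ _).sub ?_
  simpa using (MvPolynomial.isHomogeneous_C (Fin 2) a).mul (MvPolynomial.isHomogeneous_X L 1)

/-- A binary form over an algebraically closed field is a product of linear forms. -/
theorem exists_eq_prod_linForm [IsAlgClosed L] {n : ℕ} {f : MvPolynomial (Fin 2) L}
    (hf : f.IsHomogeneous n) : ∃ (c : L) (m : ℕ) (r : Multiset L), m + r.card = n ∧
      f = MvPolynomial.C c * MvPolynomial.X 1 ^ m * (r.map linForm).prod := by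
  set g : L[X] := MvPolynomial.aeval ![X, 1] f with hg
  have hdeg : g.roots.card ≤ n := (card_roots' g).trans (natDegree_aeval_X_one_le hf)
  -- The power of `T₂` accounts for the zero at infinity, that is, the drop in degree under `T₂ =
  -- 1`. Both sides have degree `n` and the same dehomogenisation `g`, hence agree.
  refine ⟨g.leadingCoeff, n - g.roots.card, g.roots, by omega, ?_⟩
  rw [← homogenize_eq_of_isHomogeneous hf hg.symm]
  have hprod : ∀ r : Multiset L, (r.map linForm).prod.IsHomogeneous r.card := by
    intro r
    induction r using Multiset.induction_on with
    | empty => simpa using MvPolynomial.isHomogeneous_one (Fin 2) L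
    | cons a r ih =>
      rw [Multiset.map_cons, Multiset.prod_cons, Multiset.card_cons, add_comm]
      exact (isHomogeneous_linForm a).mul ih
  refine homogenize_eq_of_isHomogeneous ?_ ?_
  · have := ((MvPolynomial.isHomogeneous_C (Fin 2) g.leadingCoeff).mul
      (MvPolynomial.isHomogeneous_X_pow (R := L) (1 : Fin 2) (n - g.roots.card))).mul
      (hprod g.roots)
    rwa [show 0 + (n - g.roots.card) + g.roots.card = n by omega] at this
  · conv_rhs => rw [(IsAlgClosed.splits g).eq_prod_roots]
    rw [map_mul, map_mul, map_pow, MvPolynomial.aeval_X, MvPolynomial.aeval_C, map_multiset_prod,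
      Multiset.map_map]
    simp [linForm, Function.comp_def, C_eq_algebraMap]

/-- Seminorms that agree up to a factor on linear forms define the same point. -/
theorem mk_eq_mk_of_linForm [IsAlgClosed L] {s t : HomSeminorm L} {γ : ℝ} (hγ : 0 < γ)
    (h1 : s.val (MvPolynomial.X 1) = γ * t.val (MvPolynomial.X 1))
    (h : ∀ a, s.val (linForm a) = γ * t.val (linForm a)) : mk s = mk t := by
  refine Quotient.sound ⟨γ, hγ, fun n f hf => ?_⟩
  obtain ⟨c, m, r, rfl, rfl⟩ := exists_eq_prod_linForm hf
  simp only [map_mul, map_pow, map_multiset_prod, Multiset.map_map, Function.comp_def, h1, h,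
    s.val_C, t.val_C, Multiset.prod_map_mul, Multiset.map_const', Multiset.prod_replicate]
  ring

/-- The function `|T - a|` on the Berkovich projective line, with value `∞` at infinity. -/
def absSub (a : L) : Space L → ℝ≥0∞ :=
  Quotient.lift (fun s => ENNReal.ofReal (s.val (linForm a)) /
    ENNReal.ofReal (s.val (MvPolynomial.X 1))) (by
    rintro s t ⟨c, hc, h⟩
    have h1 := h 1 _ (isHomogeneous_linForm a)
    have h2 := h 1 _ (MvPolynomial.isHomogeneous_X L 1)
    simp only [h1, h2, pow_one, ENNReal.ofReal_mul hc.le]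
    exact ENNReal.mul_div_mul_left _ _ (by simpa using hc) ENNReal.ofReal_ne_top)

theorem absSub_mk (a : L) (s : HomSeminorm L) : absSub a (mk s) =
    ENNReal.ofReal (s.val (linForm a)) / ENNReal.ofReal (s.val (MvPolynomial.X 1)) := rfl

theorem continuous_mk : Continuous (mk : HomSeminorm L → Space L) := continuous_quotient_mk'

theorem continuous_val (f : MvPolynomial (Fin 2) L) :
    Continuous fun s : HomSeminorm L => s.val f :=
  (continuous_apply f).comp continuous_induced_dom

theorem continuous_absSub (a : L) : Continuous (absSub a) := by
  refine Continuous.quotient_lift ?_ _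
  refine continuous_iff_continuousAt.mpr fun s => ?_
  refine ENNReal.Tendsto.div (ENNReal.continuous_ofReal.comp (continuous_val _)).continuousAt ?_
    (ENNReal.continuous_ofReal.comp (continuous_val _)).continuousAt (Or.inl ENNReal.ofReal_ne_top)
  -- The quotient could only be discontinuous at `0 / 0`, but `T₂` and `T₁ - a T₂` have no common
  -- zero.
  by_contra! h
  have h2 : s.val (MvPolynomial.X 1) = 0 :=
    le_antisymm (ENNReal.ofReal_eq_zero.mp h.2) (s.val_nonneg _)
  exact s.val_linForm_ne_zero h2 a (le_antisymm (ENNReal.ofReal_eq_zero.mp h.1) (s.val_nonneg _))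

theorem absSub_mk_eq_top {s : HomSeminorm L} (h : s.val (MvPolynomial.X 1) = 0) (a : L) :
    absSub a (mk s) = ⊤ := by
  rw [absSub_mk, h, ENNReal.ofReal_zero]
  refine ENNReal.div_zero ?_
  have := (s.val_nonneg (linForm a)).lt_of_ne' (s.val_linForm_ne_zero h a)
  simpa using this

theorem absSub_mk_eq_ofReal {s : HomSeminorm L} (h : s.val (MvPolynomial.X 1) ≠ 0) (a : L) :
    absSub a (mk s) = ENNReal.ofReal (s.val (linForm a) / s.val (MvPolynomial.X 1)) := by
  rw [absSub_mk, ENNReal.ofReal_div_of_pos ((s.val_nonneg _).lt_of_ne' h)]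

/-- The point `[1 : e]`. -/
theorem cons_one_ne_zero (e : L) : ![1, e] ≠ 0 := fun h => by
  simpa using congrFun h 0

/-- The point at infinity. -/
def infty (L : Type u) [NormedField L] [IsUltrametricDist L] : Space L := mk (evalSeminorm L ![1, (0 : L)] (cons_one_ne_zero 0))

@[simp]
theorem absSub_infty [IsUltrametricDist L] (a : L) : absSub a (infty L) = ⊤ := by
  refine absSub_mk_eq_top ?_ a
  change ‖MvPolynomial.aeval ![1, (0 : L)] (MvPolynomial.X 1 : MvPolynomial (Fin 2) L)‖ = 0
  simp

/-- Where `T₂` vanishes all forms `T₁ - a T₂` have the same value, so only one scale is left and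
infinity is the only such point. -/
theorem mk_eq_mk_of_val_X_one_eq_zero [IsAlgClosed L] {s t : HomSeminorm L} (hs : s.val (MvPolynomial.X 1) = 0)
    (ht : t.val (MvPolynomial.X 1) = 0) : mk s = mk t := by
  have key : ∀ (s : HomSeminorm L), s.val (MvPolynomial.X 1) = 0 →
      ∀ a, s.val (linForm a) = s.val (linForm 0) := by
    intro s hs a
    have h1 := s.val_linForm_le a 0
    have h2 := s.val_linForm_le 0 a
    rw [hs, mul_zero, max_eq_left (s.val_nonneg _)] at h1 h2
    exact le_antisymm h1 h2
  refine mk_eq_mk_of_linForm (γ := s.val (linForm 0) / t.val (linForm 0)) ?_ (by simp [hs, ht])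
    fun a => ?_
  · exact div_pos ((s.val_nonneg _).lt_of_ne' (s.val_linForm_ne_zero hs 0))
      ((t.val_nonneg _).lt_of_ne' (t.val_linForm_ne_zero ht 0))
  · rw [key s hs a, key t ht a, div_mul_cancel₀ _ (t.val_linForm_ne_zero ht 0)]

theorem affineDisc_eq (a : L) (r : ℝ) :
    affineDisc a r = {x | absSub a x < ENNReal.ofReal r} := by
  ext x
  constructor
  · rintro ⟨s, hs, rfl⟩
    have hs0 : s.val (MvPolynomial.X 1) ≠ 0 := by
      intro h
      rw [Set.mem_ofPred_eq, h, mul_zero] at hs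
      exact hs.not_ge (s.val_nonneg _)
    have hpos := (s.val_nonneg _).lt_of_ne' hs0
    have hlt := (div_lt_iff₀ hpos).mpr hs
    rw [Set.mem_ofPred_eq, absSub_mk_eq_ofReal hs0]
    exact (ENNReal.ofReal_lt_ofReal_iff_of_nonneg
      (div_nonneg (s.val_nonneg _) hpos.le)).mpr hlt
  · intro hx
    obtain ⟨s, rfl⟩ : ∃ s, mk s = x := Quotient.exists_rep x
    have hs0 : s.val (MvPolynomial.X 1) ≠ 0 := by
      intro h
      rw [Set.mem_ofPred_eq, absSub_mk_eq_top h] at hx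
      exact not_top_lt hx
    have hpos := (s.val_nonneg _).lt_of_ne' hs0
    refine ⟨s, ?_, rfl⟩
    rw [Set.mem_ofPred_eq, absSub_mk_eq_ofReal hs0, ENNReal.ofReal_lt_ofReal_iff_of_nonneg
      (div_nonneg (s.val_nonneg _) hpos.le), div_lt_iff₀ hpos] at hx
    exact hx

/-- The sign of `r` matters: `ENNReal.ofReal` truncates a negative `r` to `0`, whereas the disc
would then be the whole line. -/
theorem coDisc_eq (a : L) {r : ℝ} (hr : 0 ≤ r) :
    coDisc a r = {x | ENNReal.ofReal r < absSub a x} := by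
  have key : ∀ s : HomSeminorm L, r * s.val (MvPolynomial.X 1) < s.val (linForm a) ↔
      ENNReal.ofReal r < absSub a (mk s) := by
    intro s
    by_cases hs0 : s.val (MvPolynomial.X 1) = 0
    · rw [absSub_mk_eq_top hs0, hs0, mul_zero]
      simp [(s.val_nonneg _).lt_of_ne' (s.val_linForm_ne_zero hs0 a)]
    · rw [absSub_mk_eq_ofReal hs0, ENNReal.ofReal_lt_ofReal_iff_of_nonneg hr,
        lt_div_iff₀ ((s.val_nonneg _).lt_of_ne' hs0)]
  ext x
  constructor
  · rintro ⟨s, hs, rfl⟩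
    exact (key s).mp hs
  · intro hx
    obtain ⟨s, rfl⟩ : ∃ s, mk s = x := Quotient.exists_rep x
    exact ⟨s, (key s).mpr hx, rfl⟩

/-! ### Points as root functions -/

section Points

variable [IsUltrametricDist L] [IsAlgClosed L]

/-- The point of the affine line determined by a root function. -/
def rootPoint (d : L → ℝ) (hd : IsRootFunction d) : Space L := mk (ofRootFunction d hd)

@[simp]
theorem absSub_rootPoint (a : L) (d : L → ℝ) (hd : IsRootFunction d) :
    absSub a (rootPoint d hd) = ENNReal.ofReal (d a) := by
  rw [rootPoint, absSub_mk, ofRootFunction_linForm, ofRootFunction_X_one, ENNReal.ofReal_one,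
    div_one]

/-- A point is either infinity or given by a root function. -/
theorem eq_infty_or_eq_rootPoint (x : Space L) :
    x = infty L ∨ ∃ d hd, x = rootPoint d hd := by
  obtain ⟨s, rfl⟩ : ∃ s, mk s = x := Quotient.exists_rep x
  by_cases hs : s.val (MvPolynomial.X 1) = 0
  · refine Or.inl (mk_eq_mk_of_val_X_one_eq_zero hs ?_)
    change ‖MvPolynomial.aeval ![1, (0 : L)] (MvPolynomial.X 1 : MvPolynomial (Fin 2) L)‖ = 0
    simp
  · refine Or.inr ⟨_, s.isRootFunction hs, ?_⟩
    refine mk_eq_mk_of_linForm ((s.val_nonneg _).lt_of_ne' hs) ?_ fun a => ?_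
    · rw [ofRootFunction_X_one, mul_one]
    · rw [ofRootFunction_linForm, mul_div_cancel₀ _ hs]

/-- The functions `|T - a|` separate points. -/
theorem ext_absSub {x y : Space L} (h : ∀ a, absSub a x = absSub a y) : x = y := by
  rcases eq_infty_or_eq_rootPoint x with rfl | ⟨d, hd, rfl⟩ <;>
  rcases eq_infty_or_eq_rootPoint y with rfl | ⟨d', hd', rfl⟩
  · rfl
  · simpa using h 0
  · simpa using h 0
  · obtain rfl : d = d' := by
      funext a
      have := h a
      rwa [absSub_rootPoint, absSub_rootPoint, ENNReal.ofReal_eq_ofReal_iff (hd.nonneg a)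
        (hd'.nonneg a)] at this
    rfl

theorem absSub_eq_top_iff {x : Space L} {a : L} : absSub a x = ⊤ ↔ x = infty L := by
  rcases eq_infty_or_eq_rootPoint x with rfl | ⟨d, hd, rfl⟩
  · simp
  · simp only [absSub_rootPoint, ENNReal.ofReal_ne_top, false_iff]
    intro h
    simpa using congrArg (absSub 0) h

theorem absSub_le_max (x : Space L) (a b : L) :
    absSub a x ≤ max (absSub b x) (ENNReal.ofReal ‖a - b‖) := by
  rcases eq_infty_or_eq_rootPoint x with rfl | ⟨d, hd, rfl⟩
  · simp
  · simp only [absSub_rootPoint, ← ENNReal.ofReal_max]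
    exact ENNReal.ofReal_le_ofReal (hd.le_max a b)

theorem norm_sub_le_max_absSub (x : Space L) (a b : L) :
    ENNReal.ofReal ‖a - b‖ ≤ max (absSub a x) (absSub b x) := by
  rcases eq_infty_or_eq_rootPoint x with rfl | ⟨d, hd, rfl⟩
  · simp
  · simp only [absSub_rootPoint, ← ENNReal.ofReal_max]
    exact ENNReal.ofReal_le_ofReal (hd.norm_le_max a b)

/-- The maximal point of the closed disc of radius `t` around `b`. -/
def gaussPoint (b : L) (t : ℝ) : Space L :=
  rootPoint _ ((isRootFunction_norm_sub b).max_const t)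

theorem absSub_gaussPoint (a b : L) (t : ℝ) :
    absSub a (gaussPoint b t) = max (ENNReal.ofReal ‖a - b‖) (ENNReal.ofReal t) := by
  rw [gaussPoint, absSub_rootPoint, ENNReal.ofReal_max]

end Points

end AbsSub

/-! ### Connectedness -/

section Connectedness

variable {L : Type u} [NormedField L]

theorem isOpenBall_absSub_lt {b : L} {s : ℝ≥0∞} (h0 : s ≠ 0) (h1 : s ≠ ⊤) :
    IsOpenBall {x : Space L | absSub b x < s} :=
  ⟨b, s.toReal, ENNReal.toReal_pos h0 h1, Or.inl (by
    rw [affineDisc_eq, ENNReal.ofReal_toReal h1])⟩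

theorem isOpenBall_lt_absSub {b : L} {s : ℝ≥0∞} (h0 : s ≠ 0) (h1 : s ≠ ⊤) :
    IsOpenBall {x : Space L | s < absSub b x} :=
  ⟨b, s.toReal, ENNReal.toReal_pos h0 h1, Or.inr (by
    rw [coDisc_eq b ENNReal.toReal_nonneg, ENNReal.ofReal_toReal h1])⟩

/-- Infinity is a limit of points of the affine line. -/
theorem infty_mem_closure [IsUltrametricDist L] (hL : ∃ e : L, 1 < ‖e‖) (a : L) {t : ℝ≥0∞} (ht : t < ⊤) :
    infty L ∈ closure {x : Space L | absSub a x ∈ Set.Ioo t ⊤} := by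
  -- The points `[1 : e]` tend to infinity as `e → 0`; nontriviality of the norm ensures that `0` is
  -- not isolated.
  let q : L → Space L := fun e => mk (evalSeminorm L ![1, e] (cons_one_ne_zero e))
  have hq : Continuous q := by
    refine continuous_mk.comp (continuous_induced_rng.mpr (continuous_pi fun f => ?_))
    change Continuous fun e : L => ‖MvPolynomial.aeval ![1, e] f‖
    simp only [MvPolynomial.aeval_def, MvPolynomial.eval₂_eq_eval_map]
    refine ((MvPolynomial.continuous_eval _).comp (continuous_pi fun i => ?_)).norm
    fin_cases i
    · exact continuous_const
    · exact continuous_id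
  let _ : NontriviallyNormedField L := { ‹NormedField L› with non_trivial := hL }
  have h0 : (0 : L) ∈ closure ({0}ᶜ : Set L) := by
    rw [closure_compl_singleton]
    exact Set.mem_univ _
  have hopen : q ⁻¹' {x | t < absSub a x} ∈ 𝓝 (0 : L) := by
    refine (((isOpen_lt continuous_const (continuous_absSub a)).preimage hq)).mem_nhds ?_
    change t < absSub a (infty L)
    simpa using ht
  have h1 := mem_closure_iff_nhdsWithin_neBot.mp h0
  refine mem_closure_of_tendsto (b := 𝓝[≠] (0 : L)) (f := q)
    (hq.continuousAt.tendsto.mono_left nhdsWithin_le_nhds) ?_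
  filter_upwards [nhdsWithin_le_nhds hopen, self_mem_nhdsWithin] with e he he0
  refine ⟨he, ?_⟩
  have hX : (evalSeminorm L ![1, e] (cons_one_ne_zero e)).val (MvPolynomial.X 1) ≠ 0 := by
    change ‖MvPolynomial.aeval ![1, e] (MvPolynomial.X 1 : MvPolynomial (Fin 2) L)‖ ≠ 0
    simpa using he0
  change absSub a (mk _) < ⊤
  rw [absSub_mk_eq_ofReal hX]
  exact ENNReal.ofReal_lt_top

variable [IsUltrametricDist L] [IsAlgClosed L]

/-- The value at a fixed form is a constant times a finite product of values of `d i` at fixed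
roots. -/
theorem continuous_rootPoint {ι : Type*} [TopologicalSpace ι] {d : ι → L → ℝ}
    (hd : ∀ i, IsRootFunction (d i)) (hc : ∀ a, Continuous fun i => d i a) :
    Continuous fun i => rootPoint (d i) (hd i) := by
  refine continuous_mk.comp (continuous_induced_rng.mpr (continuous_pi fun f => ?_))
  exact continuous_const.mul (continuous_multiset_prod _ fun a _ => hc a)

theorem continuous_gaussPoint (a : L) : Continuous (gaussPoint a) :=
  continuous_rootPoint _ fun _ => continuous_const.max continuous_id

/-- The path `max d t`, for `t` from `0` to `d a`, joins a point to the Gauss point of radius `d a`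
around `a` without changing `|T - a|`. The Gauss points around `a` with radius in `J` form a
connected spine. -/
theorem isPreconnected_absSub_of_top_notMem (a : L) {J : Set ℝ≥0∞} (hJ : J.OrdConnected)
    (htop : ⊤ ∉ J) : IsPreconnected {x : Space L | absSub a x ∈ J} := by
  set I : Set ℝ := {t | 0 ≤ t ∧ ENNReal.ofReal t ∈ J} with hI
  have hIo : I.OrdConnected := ⟨fun s hs t ht r hr => ⟨hs.1.trans hr.1,
    hJ.out hs.2 ht.2 ⟨ENNReal.ofReal_le_ofReal hr.1, ENNReal.ofReal_le_ofReal hr.2⟩⟩⟩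
  have hG : IsPreconnected (gaussPoint a '' I) :=
    hIo.isPreconnected.image _ (continuous_gaussPoint a).continuousOn
  have hmemG : ∀ t ∈ I, absSub a (gaussPoint a t) ∈ J := by
    intro t ht
    rw [absSub_gaussPoint]
    simpa using ht.2
  rcases Set.eq_empty_or_nonempty I with hIe | ⟨t₀, ht₀⟩
  · have : {x : Space L | absSub a x ∈ J} = ∅ := by
      refine Set.eq_empty_of_forall_notMem fun x hx => ?_
      rcases eq_infty_or_eq_rootPoint x with rfl | ⟨d, hd, rfl⟩
      · exact htop (by simpa using hx)
      · have : d a ∈ I := ⟨hd.nonneg a, by simpa using hx⟩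
        simp [hIe] at this
    rw [this]
    exact isPreconnected_empty
  refine isPreconnected_of_forall (gaussPoint a t₀) fun x hx => ?_
  rcases eq_infty_or_eq_rootPoint x with rfl | ⟨d, hd, rfl⟩
  · exact absurd (by simpa using hx) htop
  have hda : d a ∈ I := ⟨hd.nonneg a, by simpa using hx⟩
  set p : ℝ → Space L := fun t => rootPoint _ (hd.max_const t) with hp
  have hpc : Continuous p :=
    continuous_rootPoint _ fun _ => continuous_const.max continuous_id
  have hP : IsPreconnected (p '' Set.Icc 0 (d a)) :=
    isPreconnected_Icc.image _ hpc.continuousOn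
  have hp0 : p 0 = rootPoint d hd := ext_absSub fun c => by
    simp [hp, max_eq_left (hd.nonneg c)]
  have hp1 : p (d a) = gaussPoint a (d a) := ext_absSub fun c => by
    rw [absSub_gaussPoint, ← ENNReal.ofReal_max]
    simp only [hp, absSub_rootPoint]
    congr 1
    rcases le_total (d a) (d c) with h | h
    · rw [max_eq_left h, hd.eq_max_of_le h]
    · have := hd.norm_le_max c a
      rw [max_eq_right h] at this ⊢
      rw [max_eq_right this]
  refine ⟨p '' Set.Icc 0 (d a) ∪ gaussPoint a '' I, ?_, Or.inr ⟨t₀, ht₀, rfl⟩,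
    Or.inl ⟨0, ⟨le_rfl, hd.nonneg a⟩, hp0⟩, ?_⟩
  · rintro _ (⟨t, ht, rfl⟩ | ⟨t, ht, rfl⟩)
    · simpa [hp, max_eq_left ht.2] using hx
    · exact hmemG t ht
  · exact hP.union (gaussPoint a (d a)) ⟨d a, ⟨hd.nonneg a, le_rfl⟩, hp1⟩ ⟨d a, hda, rfl⟩ hG

/-- Infinity is the only point where `|T - a| = ∞`. It is adjoined as a limit point of the affine
part, unless it is all there is. -/
theorem isPreconnected_absSub (hL : ∃ e : L, 1 < ‖e‖) (a : L) {J : Set ℝ≥0∞}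
    (hJ : J.OrdConnected) : IsPreconnected {x : Space L | absSub a x ∈ J} := by
  by_cases htop : ⊤ ∈ J
  swap
  · exact isPreconnected_absSub_of_top_notMem a hJ htop
  by_cases hex : ∃ t ∈ J, t < ⊤
  · obtain ⟨t, htJ, ht⟩ := hex
    have hJ' : (J ∩ Set.Iio ⊤).OrdConnected := hJ.inter Set.ordConnected_Iio
    refine (isPreconnected_absSub_of_top_notMem a hJ' (by simp)).subset_closure
      (fun x hx => hx.1) fun x hx => ?_
    by_cases hx' : absSub a x = ⊤
    · rw [absSub_eq_top_iff.mp hx']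
      refine closure_mono ?_ (infty_mem_closure hL a ht)
      exact fun y hy => ⟨hJ.out htJ htop ⟨hy.1.le, hy.2.le⟩, hy.2⟩
    · exact subset_closure ⟨hx, lt_top_iff_ne_top.mpr hx'⟩
  · push Not at hex
    refine Set.Subsingleton.isPreconnected fun x hx y hy => ?_
    rw [absSub_eq_top_iff.mp (top_le_iff.mp (hex _ hx)),
      absSub_eq_top_iff.mp (top_le_iff.mp (hex _ hy))]

theorem preconnectedSpace (hL : ∃ e : L, 1 < ‖e‖) : PreconnectedSpace (Space L) :=
  ⟨by simpa using isPreconnected_absSub hL (0 : L) (Set.ordConnected_univ)⟩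

/-! ### Directions at a point -/

/-- If `y` lies below `ζ` and is closer to `b` than `ζ`, then `ζ` is a Gauss point centred at
`b`. -/
theorem absSub_eq_max_of_below {y ζ : Space L} (h : ∀ c, absSub c y ≤ absSub c ζ) {b : L}
    (hb : absSub b y < absSub b ζ) (c : L) :
    absSub c ζ = max (absSub b ζ) (ENNReal.ofReal ‖c - b‖) := by
  have h1 := absSub_le_max ζ c b
  have h2 := absSub_le_max ζ b c
  have h3 := norm_sub_le_max_absSub ζ c b
  have h4 := norm_sub_le_max_absSub y c b
  have h5 := h c
  rw [norm_sub_rev] at h2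
  grind

/-- `V` is the component of `x` in the complement of `ζ`: the direction towards infinity if some `|T
- b|` is larger at `x` than at `ζ`, and otherwise a disc hanging below `ζ`. It fails to be a ball
only if `ζ` is an endpoint, and then it is the whole complement. -/
theorem exists_direction (hL : ∃ e : L, 1 < ‖e‖) {ζ x : Space L} (hx : x ≠ ζ) :
    ∃ V : Set (Space L), IsOpen V ∧ IsPreconnected V ∧ x ∈ V ∧ ζ ∉ V ∧ closure V ⊆ insert ζ V ∧
      (V = {ζ}ᶜ ∨ IsOpenBall V) := by
  by_cases hup : ∃ b, absSub b ζ < absSub b x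
  · have key : ∀ y, y ≠ ζ → y ∉ ⋃ b, {z : Space L | absSub b ζ < absSub b z} →
        (∀ c, absSub c y ≤ absSub c ζ) ∧ ∃ b, absSub b y < absSub b ζ := by
      intro y hy hyV
      simp only [Set.mem_iUnion, Set.mem_ofPred_eq, not_exists, not_lt] at hyV
      refine ⟨hyV, ?_⟩
      by_contra! h
      exact hy (ext_absSub fun c => le_antisymm (hyV c) (h c))
    have hmax : ∀ b, absSub b ζ < ⊤ := by
      obtain ⟨b, hb⟩ := hup
      intro c
      have := (hb.trans_le le_top).ne
      exact lt_top_iff_ne_top.mpr fun h => this (absSub_eq_top_iff.mpr (absSub_eq_top_iff.mp h))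
    refine ⟨⋃ b, {z | absSub b ζ < absSub b z}, isOpen_iUnion fun b =>
      isOpen_lt continuous_const (continuous_absSub b), ?_, Set.mem_iUnion.mpr hup, by simp, ?_, ?_⟩
    · exact isPreconnected_iUnion ⟨infty L, by simpa using hmax⟩
        fun b => isPreconnected_absSub hL b Set.ordConnected_Ioi
    · intro y hy
      by_contra hcon
      rw [Set.mem_insert_iff, not_or] at hcon
      obtain ⟨hle, b, hb⟩ := key y hcon.1 hcon.2
      -- The disc `|T - b| < |T - b|(ζ)` is a neighbourhood of `y` that lies below `ζ`, so it misses
      -- the union.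
      obtain ⟨z, hz, hzV⟩ := mem_closure_iff.mp hy _
        (isOpen_lt (continuous_absSub b) continuous_const) hb
      obtain ⟨c, hc⟩ := Set.mem_iUnion.mp hzV
      have h1 := absSub_eq_max_of_below hle hb c
      have h2 := absSub_le_max z c b
      simp only [Set.mem_ofPred_eq] at hc hz
      grind
    -- A missed point `y` lies below `ζ`, which makes `ζ` a Gauss point centred at some `b`; the set
    -- belonging to `b` then contains all the others.
    · by_cases hall : ∃ y, y ≠ ζ ∧ y ∉ ⋃ b, {z : Space L | absSub b ζ < absSub b z}
      · obtain ⟨y, hy, hyV⟩ := hall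
        obtain ⟨hle, b, hb⟩ := key y hy hyV
        right
        have : ⋃ b, {z : Space L | absSub b ζ < absSub b z} =
            {z : Space L | absSub b ζ < absSub b z} := by
          refine Set.Subset.antisymm (Set.iUnion_subset fun c z hz => ?_)
            (Set.subset_iUnion (fun b => {z : Space L | absSub b ζ < absSub b z}) b)
          have h1 := absSub_eq_max_of_below hle hb c
          have h2 := absSub_le_max z c b
          simp only [Set.mem_ofPred_eq] at hz ⊢
          grind
        rw [this]
        exact isOpenBall_lt_absSub (bot_lt_iff_ne_bot.mp (bot_le.trans_lt hb)) (hmax b).ne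
      · push Not at hall
        left
        refine Set.Subset.antisymm (fun y hy => ?_) fun y hy => hall y hy
        rintro rfl
        simp at hy
  · push Not at hup
    obtain ⟨b, hb⟩ : ∃ b, absSub b x < absSub b ζ := by
      by_contra! h
      exact hx (ext_absSub fun c => le_antisymm (hup c) (h c))
    refine ⟨{z | absSub b z < absSub b ζ}, isOpen_lt (continuous_absSub b) continuous_const,
      isPreconnected_absSub hL b Set.ordConnected_Iio, hb, by simp, ?_, ?_⟩
    · intro y hy
      have hle : absSub b y ≤ absSub b ζ := closure_minimal (fun z hz => le_of_lt hz)
        (isClosed_le (continuous_absSub b) continuous_const) hy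
      rcases hle.lt_or_eq with hlt | heq
      · exact Or.inr hlt
      refine Or.inl (ext_absSub fun c => ?_)
      -- Otherwise a nearby `z` in the disc is closer than the radius to both `b` and `c`. Then `b`
      -- and `c` are that close to each other, and `y` would lie inside the disc.
      have hge : absSub b ζ ≤ absSub c y := by
        by_contra! hlt
        obtain ⟨z, hz, hzb⟩ := mem_closure_iff.mp hy _
          (isOpen_lt (continuous_absSub c) continuous_const) hlt
        have h1 := norm_sub_le_max_absSub z b c
        have h2 := absSub_le_max y b c
        simp only [Set.mem_ofPred_eq] at hz hzb
        grind
      have h1 := absSub_eq_max_of_below hup hb c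
      have h2 := absSub_le_max y c b
      have h3 := norm_sub_le_max_absSub y c b
      grind
    · by_cases htop : absSub b ζ = ⊤
      · left
        ext y
        rw [absSub_eq_top_iff] at htop
        subst htop
        simp [lt_top_iff_ne_top, absSub_eq_top_iff]
      · exact Or.inr (isOpenBall_absSub_lt (bot_lt_iff_ne_bot.mp (bot_le.trans_lt hb)) htop)

end Connectedness

/-! ### A criterion for open balls -/

section Balls

variable {L : Type u} [NormedField L]

theorem IsOpenBall.isOpen {U : Set (Space L)} (hU : IsOpenBall U) : IsOpen U := by
  obtain ⟨a, r, hr, rfl | rfl⟩ := hU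
  · rw [affineDisc_eq]
    exact isOpen_lt (continuous_absSub a) continuous_const
  · rw [coDisc_eq a hr.le]
    exact isOpen_lt continuous_const (continuous_absSub a)

variable [IsUltrametricDist L] [IsAlgClosed L]

theorem IsOpenBall.isPreconnected (hL : ∃ e : L, 1 < ‖e‖) {U : Set (Space L)}
    (hU : IsOpenBall U) : IsPreconnected U := by
  obtain ⟨a, r, hr, rfl | rfl⟩ := hU
  · rw [affineDisc_eq]
    exact isPreconnected_absSub hL a Set.ordConnected_Iio
  · rw [coDisc_eq a hr.le]
    exact isPreconnected_absSub hL a Set.ordConnected_Ioi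

/-- A closed set with a single boundary point `ζ` whose complement has only one end at `ζ` is the
complement of an open ball. -/
theorem isOpenBall_compl (hL : ∃ e : L, 1 < ‖e‖) {K U : Set (Space L)} {ζ : Space L}
    (hK : IsClosed K) (hζ : ζ ∈ K) (hKo : IsOpen (K \ {ζ})) (hKn : (K \ {ζ}).Nonempty)
    (hU : IsOpen U) (hKU : K ⊆ U) (hUK : IsPreconnected (U \ K)) (hn : (U \ K).Nonempty) :
    IsOpenBall Kᶜ := by
  have hX := preconnectedSpace hL
  -- The complement of `ζ` is covered by the disjoint open sets `Kᶜ` and `K \ {ζ}`, so every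
  -- direction at `ζ` lies in one of them.
  have hdisj : Disjoint Kᶜ (K \ {ζ}) := disjoint_compl_left.mono_right Set.sdiff_subset
  have hcover : ({ζ}ᶜ : Set (Space L)) ⊆ Kᶜ ∪ K \ {ζ} := fun y hy => by
    by_cases h : y ∈ K
    · exact Or.inr ⟨h, hy⟩
    · exact Or.inl h
  have hdir : ∀ y ∉ K, ∃ V : Set (Space L), IsOpen V ∧ IsPreconnected V ∧ y ∈ V ∧ ζ ∉ V ∧
      closure V ⊆ insert ζ V ∧ (V = {ζ}ᶜ ∨ IsOpenBall V) ∧ V ⊆ Kᶜ ∧ (V ∩ (U \ K)).Nonempty := by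
    intro y hy
    obtain ⟨V, hVo, hVc, hyV, hζV, hcl, hV⟩ := exists_direction hL (ζ := ζ) (x := y)
      (fun h => hy (h ▸ hζ))
    have hsub : V ⊆ Kᶜ := hVc.subset_left_of_subset_union hK.isOpen_compl hKo hdisj
      (fun z hz => hcover (fun h => hζV (h ▸ hz))) ⟨y, hyV, hy⟩
    refine ⟨V, hVo, hVc, hyV, hζV, hcl, hV, hsub, ?_⟩
    -- A direction not accumulating at `ζ` would be clopen in a connected space.
    have hζcl : ζ ∈ closure V := by
      by_contra hcon
      have hclosed : IsClosed V := isClosed_of_closure_subset fun z hz =>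
        (hcl hz).resolve_left fun h => hcon (h ▸ hz)
      have := IsClopen.eq_univ ⟨hclosed, hVo⟩ ⟨y, hyV⟩
      exact hζV (this ▸ Set.mem_univ ζ)
    obtain ⟨z, hzU, hzV⟩ := mem_closure_iff.mp hζcl U hU (hKU hζ)
    exact ⟨z, hzV, hzU, hsub hzV⟩
  obtain ⟨x, hx⟩ := hn
  -- All directions outside `K` meet the connected set `U \ K`. So `Kᶜ` is connected and therefore
  -- consists of a single direction.
  have hconn : IsPreconnected Kᶜ := by
    refine isPreconnected_of_forall x fun y hy => ?_
    obtain ⟨V, -, hVc, hyV, -, -, -, hsub, z, hzV, hz⟩ := hdir y hy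
    exact ⟨V ∪ U \ K, Set.union_subset hsub fun w hw => hw.2, Or.inr hx, Or.inl hyV,
      hVc.union z hzV hz hUK⟩
  obtain ⟨V, hVo, -, hxV, hζV, hcl, hV, hsub, -⟩ := hdir x hx.2
  have heq : Kᶜ = V := Set.Subset.antisymm
    (hconn.subset_of_closure_inter_subset hVo ⟨x, hx.2, hxV⟩ fun z hz =>
      (hcl hz.1).resolve_left fun h => hz.2 (h ▸ hζ)) hsub
  rcases hV with rfl | hV
  · obtain ⟨w, hwK, hw⟩ := hKn
    exact absurd hwK (heq.symm ▸ hw : w ∈ Kᶜ)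
  · rwa [heq]

/-- A point of the sphere other than its Gauss point is strictly closer than `ρ` to some `c`. The
open disc of radius `ρ` around `c` stays in the sphere and misses the Gauss point. -/
theorem isOpen_absSub_eq_sdiff (a : L) (ρ : ℝ) :
    IsOpen ({x : Space L | absSub a x = ENNReal.ofReal ρ} \ {gaussPoint a ρ}) := by
  refine isOpen_iff_forall_mem_open.mpr fun x hx => ?_
  obtain ⟨hxa, hx⟩ := hx
  rw [Set.mem_ofPred_eq] at hxa
  obtain ⟨c, hc⟩ : ∃ c, absSub c x < ENNReal.ofReal ρ := by
    by_contra! h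
    refine hx (ext_absSub fun c => ?_)
    rw [absSub_gaussPoint]
    have h1 := h c
    have h2 := absSub_le_max x c a
    have h3 := norm_sub_le_max_absSub x c a
    grind
  refine ⟨{y | absSub c y < ENNReal.ofReal ρ}, fun y hy => ?_,
    isOpen_lt (continuous_absSub c) continuous_const, hc⟩
  have key : ∀ z, absSub c z < ENNReal.ofReal ρ → absSub a z = ENNReal.ofReal ρ := by
    intro z hz
    have h1 := absSub_le_max x a c
    have h2 := absSub_le_max z a c
    have h3 := norm_sub_le_max_absSub x a c
    have h4 := norm_sub_le_max_absSub z a c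
    grind
  refine ⟨key y hy, ?_⟩
  rintro rfl
  rw [Set.mem_ofPred_eq, absSub_gaussPoint] at hy
  exact (le_max_right _ _).not_gt hy

/-- An open ball is an increasing union of closed balls with one boundary point whose complement
in the open ball is connected. -/
theorem IsOpenBall.exists_exhaustion (hL : ∃ e : L, 1 < ‖e‖) {B : Set (Space L)}
    (hB : IsOpenBall B) : ∃ (C : ℕ → Set (Space L)) (η : ℕ → Space L), StrictMono C ∧
      ⋃ n, C n = B ∧ ∀ n, IsClosed (C n) ∧ η n ∈ C n ∧ IsOpen (C n \ {η n}) ∧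
        (C n \ {η n}).Nonempty ∧ IsPreconnected (B \ C n) := by
  obtain ⟨a, R, hR, rfl | rfl⟩ := hB
  -- Closed discs with radii increasing to `R`; what remains of the ball is an open annulus.
  · obtain ⟨u, hu, hmem, hlim⟩ := exists_seq_strictMono_tendsto' hR
    have hlt : ∀ {s t : ℝ}, 0 < t → s < t → ENNReal.ofReal s < ENNReal.ofReal t :=
      fun h0 h => (ENNReal.ofReal_lt_ofReal_iff h0).mpr h
    have hlim' := (ENNReal.continuous_ofReal.tendsto R).comp hlim
    have heta : ∀ n, absSub a (gaussPoint a (u n)) = ENNReal.ofReal (u n) := fun n => by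
      simp [absSub_gaussPoint]
    refine ⟨fun n => {x | absSub a x ≤ ENNReal.ofReal (u n)}, fun n => gaussPoint a (u n),
      ?_, ?_, fun n => ⟨isClosed_le (continuous_absSub a) continuous_const, (heta n).le, ?_, ?_,
        ?_⟩⟩
    · refine strictMono_nat_of_lt_succ fun n => ?_
      have h := hlt (hmem (n + 1)).1 (hu n.lt_succ_self)
      refine ⟨fun x (hx : _ ≤ _) => hx.trans h.le, fun hsub => ?_⟩
      have : absSub a (gaussPoint a (u (n + 1))) ≤ _ := hsub (heta (n + 1)).le
      rw [heta] at this
      exact this.not_gt h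
    · rw [affineDisc_eq]
      ext x
      simp only [Set.mem_iUnion, Set.mem_ofPred_eq]
      constructor
      · rintro ⟨n, hn⟩
        exact hn.trans_lt (hlt hR (hmem n).2)
      · intro hx
        obtain ⟨n, hn⟩ := (hlim'.eventually (lt_mem_nhds hx)).exists
        exact ⟨n, hn.le⟩
    · have : {x | absSub a x ≤ ENNReal.ofReal (u n)} \ {gaussPoint a (u n)} =
          {x | absSub a x < ENNReal.ofReal (u n)} ∪
          ({x | absSub a x = ENNReal.ofReal (u n)} \ {gaussPoint a (u n)}) := by
        ext x
        have : absSub a x < ENNReal.ofReal (u n) → x ≠ gaussPoint a (u n) := by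
          rintro h rfl
          exact h.ne (heta n)
        simp only [Set.mem_sdiff, Set.mem_union, Set.mem_ofPred_eq, Set.mem_singleton_iff,
          le_iff_lt_or_eq]
        tauto
      rw [this]
      exact (isOpen_lt (continuous_absSub a) continuous_const).union (isOpen_absSub_eq_sdiff a _)
    · refine ⟨gaussPoint a 0, by simp [absSub_gaussPoint], fun h => ?_⟩
      have := congrArg (absSub a) (Set.mem_singleton_iff.mp h)
      rw [heta] at this
      have h0 := (hmem n).1
      simp [absSub_gaussPoint, eq_comm] at this
      linarith
    · rw [affineDisc_eq]
      have : {x | absSub a x < ENNReal.ofReal R} \ {x | absSub a x ≤ ENNReal.ofReal (u n)} =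
          {x | absSub a x ∈ Set.Ioo (ENNReal.ofReal (u n)) (ENNReal.ofReal R)} := by
        ext x
        simp [and_comm]
      rw [this]
      exact isPreconnected_absSub hL a Set.ordConnected_Ioo
  -- Complements of open discs with radii decreasing to `R`; the upper bound `R + 1` is arbitrary.
  · obtain ⟨u, hu, hmem, hlim⟩ := exists_seq_strictAnti_tendsto' (lt_add_one R)
    have hpos : ∀ n, 0 < u n := fun n => hR.trans (hmem n).1
    have hlt : ∀ {s t : ℝ}, 0 < t → s < t → ENNReal.ofReal s < ENNReal.ofReal t :=
      fun h0 h => (ENNReal.ofReal_lt_ofReal_iff h0).mpr h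
    have hlim' := (ENNReal.continuous_ofReal.tendsto R).comp hlim
    have heta : ∀ n, absSub a (gaussPoint a (u n)) = ENNReal.ofReal (u n) := fun n => by
      simp [absSub_gaussPoint]
    refine ⟨fun n => {x | ENNReal.ofReal (u n) ≤ absSub a x}, fun n => gaussPoint a (u n),
      ?_, ?_, fun n => ⟨isClosed_le continuous_const (continuous_absSub a), (heta n).ge, ?_, ?_,
        ?_⟩⟩
    · refine strictMono_nat_of_lt_succ fun n => ?_
      have h := hlt (hpos n) (hu n.lt_succ_self)
      refine ⟨fun x (hx : _ ≤ _) => h.le.trans hx, fun hsub => ?_⟩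
      have : _ ≤ absSub a (gaussPoint a (u (n + 1))) := hsub (heta (n + 1)).ge
      rw [heta] at this
      exact this.not_gt h
    · rw [coDisc_eq a hR.le]
      ext x
      simp only [Set.mem_iUnion, Set.mem_ofPred_eq]
      constructor
      · rintro ⟨n, hn⟩
        exact (hlt (hpos n) (hmem n).1).trans_le hn
      · intro hx
        obtain ⟨n, hn⟩ := (hlim'.eventually (gt_mem_nhds hx)).exists
        exact ⟨n, hn.le⟩
    · have : {x | ENNReal.ofReal (u n) ≤ absSub a x} \ {gaussPoint a (u n)} =
          {x | ENNReal.ofReal (u n) < absSub a x} ∪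
          ({x | absSub a x = ENNReal.ofReal (u n)} \ {gaussPoint a (u n)}) := by
        ext x
        have : ENNReal.ofReal (u n) < absSub a x → x ≠ gaussPoint a (u n) := by
          rintro h rfl
          exact h.ne' (heta n)
        simp only [Set.mem_sdiff, Set.mem_union, Set.mem_ofPred_eq, Set.mem_singleton_iff,
          le_iff_lt_or_eq, eq_comm (a := absSub a x)]
        tauto
      rw [this]
      exact (isOpen_lt continuous_const (continuous_absSub a)).union (isOpen_absSub_eq_sdiff a _)
    · refine ⟨infty L, by simp, fun h => ?_⟩
      have := congrArg (absSub a) (Set.mem_singleton_iff.mp h)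
      rw [heta] at this
      simp at this
    · rw [coDisc_eq a hR.le]
      have : {x | ENNReal.ofReal R < absSub a x} \ {x | ENNReal.ofReal (u n) ≤ absSub a x} =
          {x | absSub a x ∈ Set.Ioo (ENNReal.ofReal R) (ENNReal.ofReal (u n))} := by
        ext x
        simp
      rw [this]
      exact isPreconnected_absSub hL a Set.ordConnected_Ioo

/-- Every classical point of an ultrametric disc is a centre. -/
theorem affineDisc_eq_of_mem {b c : L} {s : ℝ} (h : gaussPoint b 0 ∈ affineDisc c s) :
    affineDisc c s = affineDisc b s := by
  rw [affineDisc_eq] at h ⊢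
  rw [affineDisc_eq]
  simp only [Set.mem_ofPred_eq, absSub_gaussPoint, ENNReal.ofReal_zero, max_eq_left zero_le] at h
  ext x
  have h1 := absSub_le_max x b c
  have h2 := absSub_le_max x c b
  rw [norm_sub_rev] at h1
  simp only [Set.mem_ofPred_eq]
  grind

theorem coDisc_eq_of_notMem {b c : L} {s : ℝ} (hs : 0 ≤ s) (h : gaussPoint b 0 ∉ coDisc c s) :
    coDisc c s = coDisc b s := by
  rw [coDisc_eq c hs] at h ⊢
  rw [coDisc_eq b hs]
  simp only [Set.mem_ofPred_eq, absSub_gaussPoint, ENNReal.ofReal_zero, max_eq_left zero_le,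
    not_lt] at h
  ext x
  have h1 := absSub_le_max x b c
  have h2 := absSub_le_max x c b
  rw [norm_sub_rev] at h1
  simp only [Set.mem_ofPred_eq]
  grind

/-- An increasing union of complements of open balls is an open ball, if it omits two classical
points. -/
theorem isOpenBall_iUnion {K : ℕ → Set (Space L)} (hK : StrictMono K)
    (hball : ∀ n, IsOpenBall (K n)ᶜ) {b : L} (hb : gaussPoint b 0 ∉ ⋃ n, K n)
    (hex : infty L ∉ ⋃ n, K n ∨ ∃ b', b' ≠ b ∧ gaussPoint b' 0 ∉ ⋃ n, K n) :
    IsOpenBall (⋃ n, K n) := by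
  simp only [Set.mem_iUnion, not_exists] at hb hex
  by_cases hinf : ∃ N, infty L ∈ K N
  · obtain ⟨N, hN⟩ := hinf
    obtain ⟨b', hbb, hb'⟩ := hex.resolve_left fun h => h N hN
    -- From stage `N` on, infinity lies in `K`, so the complement is an affine disc; it contains
    -- `b`, which can serve as centre.
    have hform : ∀ n, ∃ s : ℝ, 0 < s ∧ (K (n + N))ᶜ = affineDisc b s := by
      intro n
      obtain ⟨c, s, hs, h | h⟩ := hball (n + N)
      · exact ⟨s, hs, h.trans (affineDisc_eq_of_mem (h ▸ hb _))⟩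
      · exfalso
        have : infty L ∈ (K (n + N))ᶜ := by
          rw [h, coDisc_eq c hs.le]
          simp
        exact this (hK.monotone (Nat.le_add_left N n) hN)
    choose s hs hKs using hform
    have hanti : ∀ n, s (n + 1) < s n := by
      intro n
      by_contra! hle
      have : (K (n + N))ᶜ ⊆ (K (n + 1 + N))ᶜ := by
        rw [hKs, hKs, affineDisc_eq, affineDisc_eq]
        exact fun x (hx : _ < _) => hx.trans_le (ENNReal.ofReal_le_ofReal hle)
      exact (hK (show n + N < n + 1 + N by omega)).not_ge (Set.compl_subset_compl.mp this)
    -- The second omitted point keeps the shrinking radii away from `0`; otherwise the union could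
    -- be the complement of one point.
    have hlow : ∀ n, ‖b' - b‖ ≤ s n := by
      intro n
      have : gaussPoint b' 0 ∈ affineDisc b (s n) := hKs n ▸ hb' _
      rw [affineDisc_eq] at this
      simp only [Set.mem_ofPred_eq, absSub_gaussPoint, ENNReal.ofReal_zero,
        max_eq_left zero_le] at this
      rw [norm_sub_rev]
      exact ((ENNReal.ofReal_lt_ofReal_iff (hs n)).mp this).le
    have hbdd : BddBelow (Set.range s) := ⟨_, Set.forall_mem_range.mpr hlow⟩
    have hpos : 0 < ⨅ n, s n := (norm_pos_iff.mpr (sub_ne_zero.mpr hbb)).trans_le (le_ciInf hlow)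
    have hlt : ∀ n, ⨅ n, s n < s n := fun n => (ciInf_le hbdd (n + 1)).trans_lt (hanti n)
    refine ⟨b, ⨅ n, s n, hpos, Or.inr ?_⟩
    rw [coDisc_eq b hpos.le]
    ext x
    have hmem : ∀ n, x ∈ K (n + N) ↔ ENNReal.ofReal (s n) ≤ absSub b x := by
      intro n
      rw [← not_iff_not, ← Set.mem_compl_iff, hKs, affineDisc_eq, not_le]
      rfl
    rw [Set.mem_iUnion, Set.mem_ofPred_eq]
    constructor
    · rintro ⟨n, hn⟩
      have := (hmem n).mp (hK.monotone (Nat.le_add_right n N) hn)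
      exact ((ENNReal.ofReal_lt_ofReal_iff (hs n)).mpr (hlt n)).trans_le this
    · intro hx
      by_contra! hcon
      have hxlt : ∀ n, absSub b x < ENNReal.ofReal (s n) := fun n =>
        not_le.mp fun h => hcon _ ((hmem n).mpr h)
      have hxtop := ((hxlt 0).trans ENNReal.ofReal_lt_top).ne
      have : (absSub b x).toReal ≤ ⨅ n, s n := le_ciInf fun n =>
        (ENNReal.toReal_mono ENNReal.ofReal_ne_top (hxlt n).le).trans_eq
          (ENNReal.toReal_ofReal (hs n).le)
      exact hx.not_ge ((ENNReal.le_ofReal_iff_toReal_le hxtop hpos.le).mpr this)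
  · push Not at hinf
    have hform : ∀ n, ∃ (c : L) (s : ℝ), 0 < s ∧ (K n)ᶜ = coDisc c s := by
      intro n
      obtain ⟨c, s, hs, h | h⟩ := hball n
      · exfalso
        have : infty L ∈ (K n)ᶜ := hinf n
        rw [h, affineDisc_eq] at this
        simp at this
      · exact ⟨c, s, hs, h⟩
    -- A centre of the closed disc `K 0` lies in every `K n` and is a common centre.
    obtain ⟨a, s₀, hs₀, ha⟩ := hform 0
    have haK : ∀ n, gaussPoint a 0 ∈ K n := by
      intro n
      refine hK.monotone (Nat.zero_le n) ?_
      rw [← not_not (a := _ ∈ K 0), ← Set.mem_compl_iff, ha, coDisc_eq a hs₀.le]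
      simp [absSub_gaussPoint]
    have hform' : ∀ n, ∃ s : ℝ, 0 < s ∧ (K n)ᶜ = coDisc a s := by
      intro n
      obtain ⟨c, s, hs, h⟩ := hform n
      refine ⟨s, hs, h.trans (coDisc_eq_of_notMem hs.le (h ▸ not_not.mpr (haK n)))⟩
    choose s hs hKs using hform'
    have hmono : ∀ n, s n < s (n + 1) := by
      intro n
      by_contra! hle
      have : (K n)ᶜ ⊆ (K (n + 1))ᶜ := by
        rw [hKs, hKs, coDisc_eq a (hs n).le, coDisc_eq a (hs (n + 1)).le]
        exact fun x (hx : _ < _) => (ENNReal.ofReal_le_ofReal hle).trans_lt hx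
      exact (hK n.lt_succ_self).not_ge (Set.compl_subset_compl.mp this)
    -- The omitted point `b` bounds the growing radii; otherwise the union could be the affine line.
    have hup : ∀ n, s n ≤ ‖a - b‖ := by
      intro n
      have : gaussPoint b 0 ∈ coDisc a (s n) := hKs n ▸ hb _
      rw [coDisc_eq a (hs n).le] at this
      simp only [Set.mem_ofPred_eq, absSub_gaussPoint, ENNReal.ofReal_zero,
        max_eq_left zero_le] at this
      exact ((ENNReal.ofReal_lt_ofReal_iff_of_nonneg (hs n).le).mp this).le
    have hbdd : BddAbove (Set.range s) := ⟨_, Set.forall_mem_range.mpr hup⟩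
    have hlt : ∀ n, s n < ⨆ n, s n := fun n => (hmono n).trans_le (le_ciSup hbdd (n + 1))
    have hpos : 0 < ⨆ n, s n := (hs 0).trans (hlt 0)
    refine ⟨a, ⨆ n, s n, hpos, Or.inl ?_⟩
    rw [affineDisc_eq]
    ext x
    have hmem : ∀ n, x ∈ K n ↔ absSub a x ≤ ENNReal.ofReal (s n) := by
      intro n
      rw [← not_iff_not, ← Set.mem_compl_iff, hKs, coDisc_eq a (hs n).le, not_le]
      rfl
    simp only [Set.mem_iUnion, Set.mem_ofPred_eq, hmem]
    constructor
    · rintro ⟨n, hn⟩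
      exact hn.trans_lt ((ENNReal.ofReal_lt_ofReal_iff hpos).mpr (hlt n))
    · intro hx
      have hxtop := (hx.trans ENNReal.ofReal_lt_top).ne
      rw [ENNReal.lt_ofReal_iff_toReal_lt hxtop] at hx
      obtain ⟨n, hn⟩ := exists_lt_of_lt_ciSup hx
      exact ⟨n, (ENNReal.le_ofReal_iff_toReal_le hxtop (hs n).le).mpr hn.le⟩

end Balls

/-! ### Splitting of open sets -/

section Splitting

variable {X : Type u} [TopologicalSpace X] {Φ : X → X} {U B : Set X}

/-- This form speaks of subsets of the ambient space only, and so passes easily to smaller sets and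
to unions. -/
theorem isHomeoVia_iff (hΦ : Continuous Φ) (hU : IsOpen U) (hB : IsOpen B) :
    IsHomeoVia Φ U B ↔ Set.BijOn Φ U B ∧ ∀ O ⊆ U, IsOpen O → IsOpen (Φ '' O) := by
  constructor
  · rintro ⟨h, hh⟩
    refine ⟨⟨fun x hx => hh ⟨x, hx⟩ ▸ (h ⟨x, hx⟩).2, fun x hx y hy hxy => ?_, fun y hy => ?_⟩,
      fun O hO hOo => ?_⟩
    · have : h ⟨x, hx⟩ = h ⟨y, hy⟩ := Subtype.ext (by rw [hh, hh]; exact hxy)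
      exact congrArg Subtype.val (h.injective this)
    · obtain ⟨x, hx⟩ := h.surjective ⟨y, hy⟩
      exact ⟨x, x.2, by rw [← hh, hx]⟩
    · have : Φ '' O = Subtype.val '' (h '' (Subtype.val ⁻¹' O)) := by
        ext y
        constructor
        · rintro ⟨x, hx, rfl⟩
          exact ⟨_, ⟨⟨x, hO hx⟩, hx, rfl⟩, hh _⟩
        · rintro ⟨_, ⟨x, hx, rfl⟩, rfl⟩
          exact ⟨x, hx, (hh x).symm⟩
      rw [this]
      exact hB.isOpenMap_subtype_val _ (h.isOpenMap _ (hOo.preimage continuous_subtype_val))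
  · rintro ⟨hbij, hopen⟩
    refine ⟨(Set.BijOn.equiv Φ hbij).toHomeomorphOfContinuousOpen
      ((hΦ.comp continuous_subtype_val).subtype_mk _) fun O hO => ?_, fun u => rfl⟩
    obtain ⟨O', hO', rfl⟩ := hO
    have : (Set.BijOn.equiv Φ hbij) '' (Subtype.val ⁻¹' O') =
        Subtype.val ⁻¹' (Φ '' (U ∩ O')) := by
      ext y
      constructor
      · rintro ⟨x, hx, rfl⟩
        exact ⟨x, ⟨x.2, hx⟩, rfl⟩
      · rintro ⟨x, ⟨hxU, hx⟩, hxy⟩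
        exact ⟨⟨x, hxU⟩, hx, Subtype.ext hxy⟩
    rw [this]
    exact (hopen _ Set.inter_subset_left (hU.inter hO')).preimage continuous_subtype_val

theorem IsHomeoVia.isPreconnected_inter_preimage (h : IsHomeoVia Φ U B) {D : Set X}
    (hD : IsPreconnected D) (hDB : D ⊆ B) : IsPreconnected (U ∩ Φ ⁻¹' D) := by
  obtain ⟨h, hh⟩ := h
  have h1 : IsPreconnected (Subtype.val ⁻¹' D : Set B) := by
    rw [← IsInducing.subtypeVal.isPreconnected_image, Subtype.image_preimage_coe,
      Set.inter_eq_right.mpr hDB]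
    exact hD
  have h2 := (h1.image h.symm h.symm.continuous.continuousOn).image _
    continuous_subtype_val.continuousOn
  convert! h2 using 1
  ext x
  constructor
  · rintro ⟨hxU, hx⟩
    refine ⟨⟨x, hxU⟩, ⟨h ⟨x, hxU⟩, ?_, by simp⟩, rfl⟩
    rw [Set.mem_preimage, hh]
    exact hx
  · rintro ⟨_, ⟨y, hy, rfl⟩, rfl⟩
    refine ⟨(h.symm y).2, ?_⟩
    rw [Set.mem_preimage, ← hh, h.apply_symm_apply]
    exact hy

theorem SplitsWith.mono {P Q : Set X → Prop} (h : SplitsWith P Φ B) (hPQ : ∀ U, P U → Q U) :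
    SplitsWith Q Φ B := by
  obtain ⟨𝒰, h𝒰, hd, hc⟩ := h
  exact ⟨𝒰, fun U hU => ⟨(h𝒰 U hU).1, hPQ U (h𝒰 U hU).2.1, (h𝒰 U hU).2.2⟩, hd, hc⟩

/-- Splitting is inherited by open subsets. -/
theorem SplitsWith.restrict (hΦ : Continuous Φ) (hB : IsOpen B) {B' : Set X} (hB' : IsOpen B')
    (hsub : B' ⊆ B) (h : SplitsWith (fun _ => True) Φ B) :
    SplitsWith (fun _ => True) Φ B' := by
  obtain ⟨𝒰, h𝒰, hd, hc⟩ := h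
  refine ⟨(fun U => U ∩ Φ ⁻¹' B') '' 𝒰, ?_, ?_, ?_⟩
  · rintro _ ⟨U, hU, rfl⟩
    obtain ⟨hUo, -, hh⟩ := h𝒰 U hU
    have hUo' := hUo.inter (hB'.preimage hΦ)
    refine ⟨hUo', trivial, (isHomeoVia_iff hΦ hUo' hB').mpr ?_⟩
    obtain ⟨hbij, hopen⟩ := (isHomeoVia_iff hΦ hUo hB).mp hh
    refine ⟨⟨fun x hx => hx.2, hbij.injOn.mono Set.inter_subset_left, fun y hy => ?_⟩,
      fun O hO => hopen O (hO.trans Set.inter_subset_left)⟩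
    obtain ⟨x, hx, rfl⟩ := hbij.surjOn (hsub hy)
    exact ⟨x, ⟨hx, hy⟩, rfl⟩
  · rintro _ ⟨U, hU, rfl⟩ _ ⟨V, hV, rfl⟩ hne
    exact (hd hU hV fun h => hne (by rw [h])).mono Set.inter_subset_left Set.inter_subset_left
  · rw [Set.sUnion_image, ← Set.iUnion₂_inter, ← Set.sUnion_eq_biUnion, hc]
    exact Set.inter_eq_right.mpr (Set.preimage_mono hsub)

/-- Splitting passes to increasing unions of connected open sets. -/
theorem splitsWith_iUnion (hΦ : Continuous Φ) {ι : Type*} [LinearOrder ι] {B : ι → Set X}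
    (hmono : Monotone B) (hB : ∀ i, IsOpen (B i)) (hconn : ∀ i, IsPreconnected (B i))
    (h : ∀ i, SplitsWith (fun _ => True) Φ (B i)) :
    SplitsWith (fun _ => True) Φ (⋃ i, B i) := by
  choose 𝒰 h𝒰 hd hc using h
  have hbij : ∀ {i U}, U ∈ 𝒰 i → Set.BijOn Φ U (B i) ∧ ∀ O ⊆ U, IsOpen O → IsOpen (Φ '' O) :=
    fun {i U} hU => (isHomeoVia_iff hΦ (h𝒰 i U hU).1 (hB i)).mp (h𝒰 i U hU).2.2
  -- A sheet over a smaller set is connected, so it stays inside the sheet over the larger set that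
  -- it meets.
  have hsub : ∀ {i j U V x}, i ≤ j → U ∈ 𝒰 i → V ∈ 𝒰 j → x ∈ U → x ∈ V → U ⊆ V := by
    intro i j U V x hij hU hV hxU hxV
    have hUc : IsPreconnected U := by
      have := (h𝒰 i U hU).2.2.isPreconnected_inter_preimage (hconn i) subset_rfl
      rwa [Set.inter_eq_left.mpr (show U ⊆ Φ ⁻¹' B i from (hbij hU).1.mapsTo)] at this
    have hUj : U ⊆ ⋃₀ 𝒰 j := by
      rw [hc j]
      exact fun y hy => hmono hij ((hbij hU).1.mapsTo hy)
    refine hUc.subset_left_of_subset_union (v := ⋃₀ (𝒰 j \ {V})) (h𝒰 j V hV).1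
      (isOpen_sUnion fun W hW => (h𝒰 j W hW.1).1) ?_ (fun y hy => ?_) ⟨x, hxU, hxV⟩
    · rw [Set.disjoint_sUnion_right]
      exact fun W hW => hd j hV hW.1 fun h => hW.2 h.symm
    · obtain ⟨W, hW, hyW⟩ := hUj hy
      by_cases hWV : W = V
      · exact Or.inl (hWV ▸ hyW)
      · exact Or.inr ⟨W, ⟨hW, hWV⟩, hyW⟩
  -- The sheets through `x` at all levels form a directed family; its union is the sheet through `x`
  -- over the whole union.
  let S : X → Set (Set X) := fun x => {U | x ∈ U ∧ ∃ i, U ∈ 𝒰 i}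
  have hdir : ∀ x, ∀ U ∈ S x, ∀ V ∈ S x, ∃ W ∈ S x, U ⊆ W ∧ V ⊆ W := by
    rintro x U ⟨hxU, i, hU⟩ V ⟨hxV, j, hV⟩
    rcases le_total i j with hij | hij
    · exact ⟨V, ⟨hxV, j, hV⟩, hsub hij hU hV hxU hxV, subset_rfl⟩
    · exact ⟨U, ⟨hxU, i, hU⟩, subset_rfl, hsub hij hV hU hxV hxU⟩
  have hSsub : ∀ {x y z}, z ∈ ⋃₀ S x → z ∈ ⋃₀ S y → ⋃₀ S x ⊆ ⋃₀ S y := by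
    rintro x y z ⟨U, ⟨hxU, i, hU⟩, hzU⟩ ⟨V, ⟨hyV, j, hV⟩, hzV⟩ w ⟨W, hW, hwW⟩
    obtain ⟨W', ⟨hxW', l, hW'⟩, hUW', hWW'⟩ := hdir x U ⟨hxU, i, hU⟩ W hW
    rcases le_total l j with hlj | hlj
    · exact ⟨V, ⟨hyV, j, hV⟩, hsub hlj hW' hV (hUW' hzU) hzV (hWW' hwW)⟩
    · exact ⟨W', ⟨hsub hlj hV hW' hzV (hUW' hzU) hyV, l, hW'⟩, hWW' hwW⟩
  have hself : ∀ {x i}, Φ x ∈ B i → ∃ U ∈ 𝒰 i, x ∈ U := by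
    intro x i hx
    have : x ∈ ⋃₀ 𝒰 i := hc i ▸ hx
    exact this
  refine ⟨(fun x => ⋃₀ S x) '' (Φ ⁻¹' ⋃ i, B i), ?_, ?_, ?_⟩
  · rintro _ ⟨x, hx, rfl⟩
    obtain ⟨i, hxi⟩ := Set.mem_iUnion.mp hx
    have hSo : ∀ U ∈ S x, IsOpen U := fun U hU => by
      obtain ⟨-, j, hj⟩ := hU
      exact (h𝒰 j U hj).1
    have hUo : IsOpen (⋃₀ S x) := isOpen_sUnion hSo
    refine ⟨hUo, trivial, (isHomeoVia_iff hΦ hUo (isOpen_iUnion hB)).mpr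
      ⟨⟨?_, ?_, ?_⟩, fun O hO hOo => ?_⟩⟩
    · rintro y ⟨U, ⟨-, j, hU⟩, hy⟩
      exact Set.mem_iUnion.mpr ⟨j, (hbij hU).1.mapsTo hy⟩
    · rintro y ⟨U, hU, hy⟩ z ⟨V, hV, hz⟩ hyz
      obtain ⟨W, ⟨-, j, hW⟩, hUW, hVW⟩ := hdir x U hU V hV
      exact (hbij hW).1.injOn (hUW hy) (hVW hz) hyz
    · intro y hy
      obtain ⟨j, hyj⟩ := Set.mem_iUnion.mp hy
      obtain ⟨U, hU, hxU⟩ := hself (hmono (le_max_left i j) hxi)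
      obtain ⟨z, hz, rfl⟩ := (hbij hU).1.surjOn (hmono (le_max_right i j) hyj)
      exact ⟨z, ⟨U, ⟨hxU, _, hU⟩, hz⟩, rfl⟩
    · have : Φ '' O = ⋃ U ∈ S x, Φ '' (O ∩ U) := by
        rw [← Set.image_iUnion₂, ← Set.inter_iUnion₂, ← Set.sUnion_eq_biUnion,
          Set.inter_eq_left.mpr hO]
      rw [this]
      refine isOpen_biUnion fun U hU => ?_
      obtain ⟨-, j, hj⟩ := hU
      exact (hbij hj).2 _ Set.inter_subset_right (hOo.inter (h𝒰 j U hj).1)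
  · rintro _ ⟨x, hx, rfl⟩ _ ⟨y, hy, rfl⟩ hne
    refine Set.disjoint_left.mpr fun z hzx hzy => hne ?_
    exact Set.Subset.antisymm (hSsub hzx hzy) (hSsub hzy hzx)
  · ext x
    constructor
    · rintro ⟨_, ⟨y, hy, rfl⟩, U, ⟨-, j, hU⟩, hxU⟩
      exact Set.mem_iUnion.mpr ⟨j, (hbij hU).1.mapsTo hxU⟩
    · intro hx
      obtain ⟨i, hxi⟩ := Set.mem_iUnion.mp hx
      obtain ⟨U, hU, hxU⟩ := hself hxi
      exact ⟨_, ⟨x, hx, rfl⟩, U, ⟨hxU, i, hU⟩, hxU⟩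

end Splitting

/-! ### The set of splitting radii -/

section SplittingRadii

/-- A ball around a classical point is a disc around it, or a disc around infinity. -/
theorem ball_cases {L : Type u} [NormedField L] (p : Projectivization L (Fin 2 → L)) :
    (∃ b : L, ∀ r, ball p r = affineDisc b r) ∨ ∀ r, 0 < r → ball p r = coDisc 0 r⁻¹ := by
  by_cases hp : p.rep 1 = 0
  · refine Or.inr fun r hr => ?_
    rw [ball, if_pos hp, coDisc]
    congr 1
    ext s
    rw [Set.mem_ofPred_eq, Set.mem_ofPred_eq, inv_mul_lt_iff₀ hr]
    simp [linForm]
  · exact Or.inl ⟨p.rep 0 / p.rep 1, fun r => by rw [ball, if_neg hp]⟩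

variable {L : Type u} [NormedField L] (p : Projectivization L (Fin 2 → L))

theorem isOpenBall_ball {r : ℝ} (hr : 0 < r) : IsOpenBall (ball p r) := by
  rcases ball_cases p with ⟨b, h⟩ | h
  · exact ⟨b, r, hr, Or.inl (h r)⟩
  · exact ⟨0, r⁻¹, inv_pos.mpr hr, Or.inr (h r hr)⟩

theorem ball_subset_ball {r R : ℝ} (hr : 0 < r) (h : r ≤ R) : ball p r ⊆ ball p R := by
  rcases ball_cases p with ⟨b, hb⟩ | hb
  · rw [hb, hb, affineDisc_eq, affineDisc_eq]
    exact fun x (hx : _ < _) => hx.trans_le (ENNReal.ofReal_le_ofReal h)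
  · have hR := hr.trans_le h
    rw [hb r hr, hb R hR, coDisc_eq _ (inv_pos.mpr hr).le, coDisc_eq _ (inv_pos.mpr hR).le]
    exact fun x (hx : _ < _) => (ENNReal.ofReal_le_ofReal (inv_anti₀ hr h)).trans_lt hx

theorem ball_eq_iUnion {R : ℝ} (hR : 0 < R) : ball p R = ⋃ r : Set.Ioo 0 R, ball p r := by
  refine Set.Subset.antisymm (fun x hx => ?_)
    (Set.iUnion_subset fun r => ball_subset_ball p r.2.1 r.2.2.le)
  rw [Set.mem_iUnion]
  rcases ball_cases p with ⟨b, hb⟩ | hb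
  · rw [hb, affineDisc_eq] at hx
    have hxtop := (hx.trans ENNReal.ofReal_lt_top).ne
    rw [Set.mem_ofPred_eq, ENNReal.lt_ofReal_iff_toReal_lt hxtop] at hx
    obtain ⟨r, hr, hrR⟩ := exists_between hx
    have hr0 := ENNReal.toReal_nonneg.trans_lt hr
    refine ⟨⟨r, hr0, hrR⟩, ?_⟩
    rw [hb, affineDisc_eq]
    exact (ENNReal.lt_ofReal_iff_toReal_lt hxtop).mpr hr
  · rw [hb R hR, coDisc_eq _ (inv_pos.mpr hR).le, Set.mem_ofPred_eq] at hx
    obtain ⟨t, ht, htx⟩ := exists_between hx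
    have httop := (htx.trans_le le_top).ne
    have ht' : R⁻¹ < t.toReal := (ENNReal.ofReal_lt_iff_lt_toReal (inv_pos.mpr hR).le httop).mp ht
    have ht0 : 0 < t.toReal := (inv_pos.mpr hR).trans ht'
    refine ⟨⟨t.toReal⁻¹, inv_pos.mpr ht0, inv_lt_of_inv_lt₀ hR ht'⟩, ?_⟩
    rw [hb _ (inv_pos.mpr ht0), inv_inv, coDisc_eq _ ht0.le, Set.mem_ofPred_eq,
      ENNReal.ofReal_toReal httop]
    exact htx

variable {p}

theorem FiniteMorphism.continuous_an (φ : FiniteMorphism L) : Continuous φ.an := by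
  refine Continuous.quotient_map' ?_ _
  exact continuous_induced_rng.mpr (continuous_pi fun f => continuous_val _)

theorem Splits.ball_of_le {φ : FiniteMorphism L} {r R : ℝ} (hr : 0 < r) (hrR : r ≤ R)
    (h : Splits φ (ball p R)) : Splits φ (ball p r) :=
  SplitsWith.restrict φ.continuous_an (isOpenBall_ball p (hr.trans_le hrR)).isOpen
    (isOpenBall_ball p hr).isOpen (ball_subset_ball p hr hrR) h

theorem SplitsIntoBalls.splits {φ : FiniteMorphism L} {B : Set (Space L)}
    (h : SplitsIntoBalls φ B) : Splits φ B :=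
  SplitsWith.mono h fun _ _ => trivial

theorem IsCappedRadius.splits {φ : FiniteMorphism L} {v : ℝ} (h : IsCappedRadius φ p v)
    (hv : 0 < v) : Splits φ (ball p v) := by
  rcases h with ⟨-, rfl⟩ | ⟨R, ⟨hR, -⟩, rfl⟩ | ⟨hb, rfl⟩
  · exact absurd hv (lt_irrefl _)
  · exact hR.2.ball_of_le hv (min_le_right _ _)
  · obtain ⟨r, hr, hr1⟩ := not_bddAbove_iff.mp hb 1
    exact hr.2.ball_of_le hv hr1.le

theorem IsCappedRadius.le {φ : FiniteMorphism L} {v r : ℝ} (h : IsCappedRadius φ p v)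
    (hr : 0 < r) (hr1 : r ≤ 1) (hs : Splits φ (ball p r)) : r ≤ v := by
  rcases h with ⟨he, -⟩ | ⟨R, ⟨-, hR⟩, rfl⟩ | ⟨-, rfl⟩
  · have : r ∈ (∅ : Set ℝ) := he ▸ ⟨hr, hs⟩
    exact this.elim
  · exact le_min hr1 (hR ⟨hr, hs⟩)
  · exact hr1

end SplittingRadii

/-! ### Preimages of balls -/

section Morphism

variable {L : Type u} [NormedField L]

/-- A form of positive degree over an algebraically closed field has a zero. -/
theorem exists_zero_of_isHomogeneous [IsAlgClosed L] {n : ℕ} (hn : 0 < n)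
    {f : MvPolynomial (Fin 2) L} (hf : f.IsHomogeneous n) :
    ∃ v : Fin 2 → L, v ≠ 0 ∧ MvPolynomial.aeval v f = 0 := by
  obtain ⟨c, m, r, hmr, rfl⟩ := exists_eq_prod_linForm hf
  rcases r.empty_or_exists_mem with rfl | ⟨b, hb⟩
  · refine ⟨![1, 0], cons_one_ne_zero 0, ?_⟩
    have : m ≠ 0 := by simp at hmr; omega
    simp [this]
  · refine ⟨![b, 1], fun h => by simpa using congrFun h 1, ?_⟩
    rw [map_mul, map_multiset_prod, Multiset.map_map,
      Multiset.prod_eq_zero (Multiset.mem_map.mpr ⟨b, hb, by simp [linForm]⟩), mul_zero]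

theorem FiniteMorphism.aeval_form_ne_zero (φ : FiniteMorphism L) {v : Fin 2 → L} (hv : v ≠ 0) :
    (fun i => MvPolynomial.aeval v (φ.form i)) ≠ 0 := by
  intro h
  refine hv (funext fun i => ?_)
  obtain ⟨n, hn⟩ := φ.no_common_zero i
  have hle : Ideal.span (Set.range φ.form) ≤ RingHom.ker (MvPolynomial.aeval v) := by
    rw [Ideal.span_le]
    rintro _ ⟨j, rfl⟩
    exact congrFun h j
  have := hle hn
  rw [RingHom.mem_ker, map_pow, MvPolynomial.aeval_X] at this
  exact eq_zero_of_pow_eq_zero this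

/-! ### Classical points and their images -/

variable [IsUltrametricDist L]

theorem FiniteMorphism.an_mk_evalSeminorm (φ : FiniteMorphism L) {v : Fin 2 → L} (hv : v ≠ 0) :
    φ.an (P1An.mk (evalSeminorm L v hv)) =
      P1An.mk (evalSeminorm L _ (φ.aeval_form_ne_zero hv)) := by
  refine Quotient.sound ⟨1, one_pos, fun n f _ => ?_⟩
  rw [one_pow, one_mul]
  change ‖MvPolynomial.aeval v (MvPolynomial.aeval φ.form f)‖ = ‖MvPolynomial.aeval _ f‖
  rw [MvPolynomial.comp_aeval_apply]

theorem evalSeminorm_X_one {v : Fin 2 → L} (hv : v ≠ 0) :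
    (evalSeminorm L v hv).val (MvPolynomial.X 1) = ‖v 1‖ := by
  change ‖MvPolynomial.aeval v (MvPolynomial.X 1 : MvPolynomial (Fin 2) L)‖ = _
  simp

theorem evalSeminorm_linForm {v : Fin 2 → L} (hv : v ≠ 0) (a : L) :
    (evalSeminorm L v hv).val (linForm a) = ‖v 0 - a * v 1‖ := by
  change ‖MvPolynomial.aeval v (linForm a)‖ = _
  simp [linForm]

variable [IsAlgClosed L]

theorem mk_evalSeminorm_eq_of_smul {v w : Fin 2 → L} (hv : v ≠ 0) (hw : w ≠ 0) {c : L}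
    (h : v = c • w) : mk (evalSeminorm L v hv) = mk (evalSeminorm L w hw) := by
  have hc : c ≠ 0 := by
    rintro rfl
    exact hv (by simpa using h)
  refine mk_eq_mk_of_linForm (norm_pos_iff.mpr hc) ?_ fun a => ?_
  · simp [evalSeminorm_X_one, h]
  · rw [evalSeminorm_linForm, evalSeminorm_linForm, h, ← norm_mul]
    simp only [Pi.smul_apply, smul_eq_mul]
    ring_nf

/-- The points that come from `L`-points of the projective line. -/
def IsClassical (x : Space L) : Prop := x = infty L ∨ ∃ b, x = gaussPoint b 0

theorem isClassical_mk_evalSeminorm {v : Fin 2 → L} (hv : v ≠ 0) :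
    IsClassical (mk (evalSeminorm L v hv)) := by
  by_cases h1 : v 1 = 0
  · refine Or.inl (mk_eq_mk_of_val_X_one_eq_zero ?_ ?_) <;> simp [evalSeminorm_X_one, h1]
  · refine Or.inr ⟨v 0 / v 1, ext_absSub fun a => ?_⟩
    have hX : (evalSeminorm L v hv).val (MvPolynomial.X 1) ≠ 0 := by
      simpa [evalSeminorm_X_one] using h1
    rw [absSub_mk_eq_ofReal hX, absSub_gaussPoint, ENNReal.ofReal_zero,
      max_eq_left zero_le, evalSeminorm_X_one, evalSeminorm_linForm, ← norm_div, norm_sub_rev a]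
    congr 2
    field_simp

theorem IsClassical.exists_eq_mk {x : Space L} (hx : IsClassical x) :
    ∃ (v : Fin 2 → L) (hv : v ≠ 0), x = mk (evalSeminorm L v hv) := by
  rcases hx with rfl | ⟨b, rfl⟩
  · exact ⟨_, cons_one_ne_zero 0, rfl⟩
  · have hv : ![b, 1] ≠ 0 := fun h => by simpa using congrFun h 1
    refine ⟨![b, 1], hv, ext_absSub fun a => ?_⟩
    have hX : (evalSeminorm L ![b, 1] hv).val (MvPolynomial.X 1) ≠ 0 := by
      simp [evalSeminorm_X_one]
    rw [absSub_mk_eq_ofReal hX, absSub_gaussPoint, ENNReal.ofReal_zero,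
      max_eq_left zero_le, evalSeminorm_X_one, evalSeminorm_linForm, norm_sub_rev a]
    simp

/-- A finite morphism is surjective on classical points. -/
theorem FiniteMorphism.exists_isClassical_an_eq (φ : FiniteMorphism L) {y : Space L}
    (hy : IsClassical y) : ∃ x, IsClassical x ∧ φ.an x = y := by
  obtain ⟨w, hw, rfl⟩ := hy.exists_eq_mk
  -- The preimages of `[w 0 : w 1]` are the zeros of this form, which has positive degree.
  have hf : (MvPolynomial.C (w 1) * φ.form 0 - MvPolynomial.C (w 0) * φ.form 1).IsHomogeneous
      φ.deg := by
    have := ((MvPolynomial.isHomogeneous_C (Fin 2) (w 1)).mul (φ.homogeneous 0)).sub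
      ((MvPolynomial.isHomogeneous_C (Fin 2) (w 0)).mul (φ.homogeneous 1))
    rwa [zero_add] at this
  obtain ⟨v, hv, hv0⟩ := exists_zero_of_isHomogeneous φ.deg_pos hf
  refine ⟨_, isClassical_mk_evalSeminorm hv, ?_⟩
  rw [φ.an_mk_evalSeminorm hv]
  simp only [map_sub, map_mul, MvPolynomial.aeval_C, Algebra.algebraMap_self, RingHom.id_apply]
    at hv0
  set u : Fin 2 → L := fun i => MvPolynomial.aeval v (φ.form i)
  have hu0 : w 1 * u 0 = w 0 * u 1 := sub_eq_zero.mp hv0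
  obtain ⟨c, hc⟩ : ∃ c : L, u = c • w := by
    by_cases h1 : w 1 = 0
    · have h0 : w 0 ≠ 0 := fun h0 => hw (funext fun i => by fin_cases i <;> assumption)
      have hu1 : u 1 = 0 := by simpa [h1, h0] using hu0
      refine ⟨u 0 / w 0, funext fun i => ?_⟩
      match i with
      | 0 => rw [Pi.smul_apply, smul_eq_mul, div_mul_cancel₀ _ h0]
      | 1 => rw [Pi.smul_apply, smul_eq_mul, h1, hu1, mul_zero]
    · refine ⟨u 1 / w 1, funext fun i => ?_⟩
      match i with
      | 0 =>
        rw [Pi.smul_apply, smul_eq_mul, div_mul_eq_mul_div, eq_div_iff h1]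
        linear_combination hu0
      | 1 => rw [Pi.smul_apply, smul_eq_mul, div_mul_cancel₀ _ h1]
  exact mk_evalSeminorm_eq_of_smul _ hw hc

/-- The complement of an open ball contains two classical points. -/
theorem IsOpenBall.exists_isClassical_notMem (hL : ∃ e : L, 1 < ‖e‖) {B : Set (Space L)}
    (hB : IsOpenBall B) : ∃ x y, IsClassical x ∧ IsClassical y ∧ x ≠ y ∧ x ∉ B ∧ y ∉ B := by
  let _ : NontriviallyNormedField L := { ‹NormedField L› with non_trivial := hL }
  obtain ⟨a, r, hr, rfl | rfl⟩ := hB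
  · obtain ⟨e, he⟩ := NormedField.exists_lt_norm L r
    refine ⟨infty L, gaussPoint (a + e) 0, Or.inl rfl, Or.inr ⟨_, rfl⟩, fun h => ?_, ?_, ?_⟩
    · have := congrArg (absSub 0) h
      rw [absSub_infty, absSub_gaussPoint, ← ENNReal.ofReal_max] at this
      exact ENNReal.ofReal_ne_top this.symm
    · simp [affineDisc_eq]
    · simpa [affineDisc_eq, absSub_gaussPoint] using ENNReal.ofReal_le_ofReal he.le
  · obtain ⟨e, he0, he⟩ := NormedField.exists_norm_lt L hr
    refine ⟨gaussPoint a 0, gaussPoint (a + e) 0, Or.inr ⟨_, rfl⟩, Or.inr ⟨_, rfl⟩, fun h => ?_,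
      ?_, ?_⟩
    · have := congrArg (absSub a) h
      simp [absSub_gaussPoint, eq_comm] at this
      simp [this] at he0
    · simp [coDisc_eq a hr.le, absSub_gaussPoint]
    · simpa [coDisc_eq a hr.le, absSub_gaussPoint] using ENNReal.ofReal_le_ofReal he.le

/-- A clopen part of the preimage of an open ball that maps homeomorphically onto the ball is an
open ball. -/
theorem FiniteMorphism.isOpenBall_of_isHomeoVia (hL : ∃ e : L, 1 < ‖e‖) (φ : FiniteMorphism L)
    {B U : Set (Space L)} (hB : IsOpenBall B) (hU : IsOpen U)
    (hcl : closure U ∩ φ.an ⁻¹' B ⊆ U) (h : IsHomeoVia φ.an U B) : IsOpenBall U := by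
  have hbij := ((isHomeoVia_iff φ.continuous_an hU hB.isOpen).mp h).1
  obtain ⟨C, η, hC, hCB, hprop⟩ := hB.exists_exhaustion hL
  have hCsub : ∀ n, C n ⊆ B := fun n => hCB ▸ Set.subset_iUnion C n
  have hlift : ∀ D ⊆ B, φ.an '' (U ∩ φ.an ⁻¹' D) = D := fun D hD => by
    rw [Set.image_inter_preimage, hbij.image_eq, Set.inter_eq_right.mpr hD]
  set K : ℕ → Set (Space L) := fun n => U ∩ φ.an ⁻¹' C n with hKdef
  have hKU : ⋃ n, K n = U := by
    rw [hKdef, ← Set.inter_iUnion, ← Set.preimage_iUnion, hCB,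
      Set.inter_eq_left.mpr (show U ⊆ φ.an ⁻¹' B from hbij.mapsTo)]
  have hK : StrictMono K := by
    refine strictMono_nat_of_lt_succ fun n => ?_
    refine ⟨Set.inter_subset_inter_right _ (Set.preimage_mono (hC n.lt_succ_self).1),
      fun hsub => ?_⟩
    have := Set.image_mono (f := φ.an) hsub
    simp only [hKdef] at this
    rw [hlift _ (hCsub _), hlift _ (hCsub _)] at this
    exact (hC n.lt_succ_self).2 this
  have hball : ∀ n, IsOpenBall (K n)ᶜ := by
    intro n
    obtain ⟨hcC, hηC, hηo, hηn, hconn⟩ := hprop n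
    -- The point of `U` over the boundary point `η n` is the only possible boundary point of `K n`.
    obtain ⟨ζ, hζU, hζ⟩ := hbij.surjOn (hCsub n hηC)
    have hdiff : K n \ {ζ} = U ∩ φ.an ⁻¹' (C n \ {η n}) := by
      ext x
      simp only [hKdef, Set.mem_sdiff, Set.mem_inter_iff, Set.mem_preimage, Set.mem_singleton_iff,
        ← hζ]
      constructor
      · rintro ⟨⟨hx, hxC⟩, hne⟩
        exact ⟨hx, hxC, fun heq => hne (hbij.injOn hx hζU heq)⟩
      · rintro ⟨hx, hxC, hne⟩
        exact ⟨⟨hx, hxC⟩, fun heq => hne (heq ▸ rfl)⟩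
    have hUdiff : U \ K n = U ∩ φ.an ⁻¹' (B \ C n) := by
      ext x
      simp only [hKdef, Set.mem_sdiff, Set.mem_inter_iff, Set.mem_preimage]
      have := fun hx : x ∈ U => hbij.mapsTo hx
      tauto
    refine isOpenBall_compl hL (ζ := ζ) (U := U) ?_ ⟨hζU, by rwa [Set.mem_preimage, hζ]⟩ ?_ ?_ hU
      Set.inter_subset_left ?_ ?_
    -- `K n` is closed in the whole line: a limit point maps into the closed set `C n ⊆ B`, and `U`
    -- is relatively closed over `B`.
    · refine isClosed_of_closure_subset fun x hx => ?_
      have hxC : φ.an x ∈ C n := closure_minimal (fun y hy => hy.2)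
        (hcC.preimage φ.continuous_an) hx
      exact ⟨hcl ⟨closure_mono Set.inter_subset_left hx, hCsub n hxC⟩, hxC⟩
    · rw [hdiff]
      exact hU.inter (hηo.preimage φ.continuous_an)
    · rw [hdiff]
      refine Set.Nonempty.of_image (f := φ.an) ?_
      rwa [hlift _ (Set.sdiff_subset.trans (hCsub n))]
    · rw [hUdiff]
      exact h.isPreconnected_inter_preimage hconn Set.sdiff_subset
    · obtain ⟨x, hx, hxn⟩ := Set.exists_of_ssubset (hK n.lt_succ_self)
      exact ⟨x, hx.1, hxn⟩
  -- Classical preimages of two classical points outside `B` are distinct and lie outside `U`.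
  obtain ⟨y₁, y₂, hy₁, hy₂, hne, hy₁B, hy₂B⟩ := hB.exists_isClassical_notMem hL
  obtain ⟨x₁, hx₁, rfl⟩ := φ.exists_isClassical_an_eq hy₁
  obtain ⟨x₂, hx₂, rfl⟩ := φ.exists_isClassical_an_eq hy₂
  have hx₁U : x₁ ∉ ⋃ n, K n := hKU ▸ fun hx => hy₁B (hbij.mapsTo hx)
  have hx₂U : x₂ ∉ ⋃ n, K n := hKU ▸ fun hx => hy₂B (hbij.mapsTo hx)
  rw [← hKU]
  rcases hx₁ with rfl | ⟨b₁, rfl⟩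
  · rcases hx₂ with rfl | ⟨b₂, rfl⟩
    · exact absurd rfl hne
    · exact isOpenBall_iUnion hK hball hx₂U (Or.inl hx₁U)
  · rcases hx₂ with rfl | ⟨b₂, rfl⟩
    · exact isOpenBall_iUnion hK hball hx₁U (Or.inl hx₂U)
    · exact isOpenBall_iUnion hK hball hx₁U (Or.inr ⟨b₂, fun h => hne (h ▸ rfl), hx₂U⟩)

/-- An open ball that splits splits into balls. -/
theorem Splits.splitsIntoBalls (hL : ∃ e : L, 1 < ‖e‖) {φ : FiniteMorphism L}
    {B : Set (Space L)} (hB : IsOpenBall B) (h : Splits φ B) : SplitsIntoBalls φ B := by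
  obtain ⟨𝒰, h𝒰, hd, hc⟩ := h
  refine ⟨𝒰, fun U hU => ⟨(h𝒰 U hU).1, ?_, (h𝒰 U hU).2.2⟩, hd, hc⟩
  -- The other sheets are open and disjoint from `U`, which makes `U` closed in the preimage of `B`.
  refine φ.isOpenBall_of_isHomeoVia hL hB (h𝒰 U hU).1 ?_ (h𝒰 U hU).2.2
  rintro x ⟨hxcl, hxB⟩
  rw [← hc] at hxB
  obtain ⟨V, hV, hxV⟩ := hxB
  obtain ⟨y, hyV, hyU⟩ := mem_closure_iff.mp hxcl V (h𝒰 V hV).1 hxV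
  by_contra hxU
  exact Set.disjoint_left.mp (hd hU hV fun h => hxU (h ▸ hxV)) hyU hyV

/-! ### The largest splitting radius -/

variable {p : Projectivization L (Fin 2 → L)}

/-- This is what makes the supremum of the splitting radii a maximum. -/
theorem splits_ball_of_forall_lt (hL : ∃ e : L, 1 < ‖e‖) {φ : FiniteMorphism L} {R : ℝ}
    (hR : 0 < R) (h : ∀ r, 0 < r → r < R → Splits φ (ball p r)) : Splits φ (ball p R) := by
  rw [ball_eq_iUnion p hR]
  exact splitsWith_iUnion φ.continuous_an
    (fun r s hrs => ball_subset_ball p r.2.1 hrs)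
    (fun r => (isOpenBall_ball p r.2.1).isOpen)
    (fun r => (isOpenBall_ball p r.2.1).isPreconnected hL)
    (fun r => h r r.2.1 r.2.2)

/-- The capped radius is the largest radius `≤ 1` of a ball that splits into balls. -/
theorem isCappedRadius_of_splitsIntoBalls (hL : ∃ e : L, 1 < ‖e‖) {φ : FiniteMorphism L} {v : ℝ}
    (h0 : 0 ≤ v) (h1 : v ≤ 1) (hs : 0 < v → SplitsIntoBalls φ (ball p v))
    (hmax : ∀ r : ℝ, 0 < r → r ≤ 1 → SplitsIntoBalls φ (ball p r) → r ≤ v) :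
    IsCappedRadius φ p v := by
  -- Splitting descends to the radius `min 1 r`, where the sheets are balls and maximality of `v`
  -- applies.
  have hle : ∀ r, 0 < r → Splits φ (ball p r) → min 1 r ≤ v := by
    intro r hr h
    have hpos : 0 < min 1 r := lt_min one_pos hr
    exact hmax _ hpos (min_le_left _ _)
      ((h.ball_of_le hpos (min_le_right _ _)).splitsIntoBalls hL (isOpenBall_ball p hpos))
  rcases h0.eq_or_lt with rfl | hv
  · refine Or.inl ⟨Set.eq_empty_of_forall_notMem fun r hr => ?_, rfl⟩
    exact (hle r hr.1 hr.2).not_gt (lt_min one_pos hr.1)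
  have hvS : v ∈ {r | 0 < r ∧ Splits φ (ball p r)} := ⟨hv, (hs hv).splits⟩
  by_cases hbdd : BddAbove {r | 0 < r ∧ Splits φ (ball p r)}
  · refine Or.inr (Or.inl ?_)
    set R := sSup {r | 0 < r ∧ Splits φ (ball p r)} with hRdef
    have hvR : v ≤ R := le_csSup hbdd hvS
    have hR : 0 < R := hv.trans_le hvR
    have hRS : Splits φ (ball p R) := by
      refine splits_ball_of_forall_lt hL hR fun r hr hrR => ?_
      obtain ⟨r', hr', hlt⟩ := exists_lt_of_lt_csSup ⟨v, hvS⟩ hrR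
      exact hr'.2.ball_of_le hr hlt.le
    exact ⟨R, ⟨⟨hR, hRS⟩, fun r hr => le_csSup hbdd hr⟩,
      le_antisymm (le_min h1 hvR) (hle R hR hRS)⟩
  · refine Or.inr (Or.inr ⟨hbdd, le_antisymm h1 ?_⟩)
    rw [not_bddAbove_iff] at hbdd
    obtain ⟨r, hr, hr1⟩ := hbdd 1
    simpa [hr1.le] using hle r hr.1 hr.2

end Morphism

/-! ### Comparison of the two theorems -/

section Comparison

variable {k : Type u} [NontriviallyNormedField k] {c : ℝ} {φ : FiniteMorphism k}
  {I : GeneralizedInterval} {ψ : I.carrier × Space k → Space k}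

theorem exists_one_lt_norm (k : Type u) [NontriviallyNormedField k] (L : Type u) [NormedField L]
    [NormedAlgebra k L] : ∃ e : L, 1 < ‖e‖ := by
  obtain ⟨e, he⟩ := NormedField.exists_one_lt_norm k
  exact ⟨algebraMap k L e, by rwa [norm_algebraMap']⟩

theorem IsDeformationRetraction.finalMap_of_mem {X : Type u} [TopologicalSpace X]
    {ψ : I.carrier × X → X} (h : IsDeformationRetraction ψ) {y : X} (hy : y ∈ image ψ) :
    finalMap ψ y = y :=
  h.fixes_image ⊤ y hy

/-- `M` is the restriction of `f` to the image; constancy on fibres carries its value at `γ` to all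
points retracting to `γ`. -/
theorem RadiusData.exists_skeletonData {f : Space k → NNReal} (h : RadiusData c φ f ψ) :
    ∃ M : image ψ → Set.Icc (0 : NNReal) 1,
      (∀ x, (M (toImage ψ x) : NNReal) = f x) ∧ SkeletonData c φ ψ M := by
  refine ⟨fun γ => ⟨f γ, zero_le, h.isRadiusFunction.1 γ⟩,
    fun x => (h.constant_on_fibres x).symm, ?_⟩
  refine ⟨h.isDeformationRetraction, h.finite_complex, ?_, h.piecewise_linear, ?_, ?_⟩
  · obtain ⟨x, hx⟩ := h.not_zero
    exact ⟨toImage ψ x, (h.constant_on_fibres x).symm.trans_ne hx⟩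
  · intro γ hγ x hxγ L _ _ _ _ _ p hp
    have hr := h.isRadiusFunction.2 L x p hp
    rw [h.constant_on_fibres x, hxγ] at hr
    exact (hr.splits hγ).splitsIntoBalls (exists_one_lt_norm k L) (isOpenBall_ball p hγ)
  · intro γ x hxγ L _ _ _ _ _ p hp r hr0 hr1 hs
    have hr := h.isRadiusFunction.2 L x p hp
    rw [h.constant_on_fibres x, hxγ] at hr
    exact hr.le hr0 hr1 hs.splits

/-- Independence of `L` and `x_L` comes for free, since one number `M γ` serves all of them; what
needs proof is that the maximum exists. -/
theorem SkeletonData.radiusData {M : image ψ → Set.Icc (0 : NNReal) 1}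
    (h : SkeletonData c φ ψ M) :
    RadiusData c φ (fun x => (M (toImage ψ x) : NNReal)) ψ := by
  -- The final map is the identity on the image, so the composite with the retraction restricts to
  -- `M` there.
  have hfix : ∀ γ : image ψ, toImage ψ γ = γ := fun γ =>
    Subtype.ext (h.isDeformationRetraction.finalMap_of_mem γ.2)
  refine ⟨⟨fun x => (M _).2.2, fun L _ _ _ _ _ x p hp => ?_⟩, ?_, h.isDeformationRetraction,
    h.finite_complex, fun x => ?_, ?_⟩
  · exact isCappedRadius_of_splitsIntoBalls (exists_one_lt_norm k L) (NNReal.coe_nonneg _)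
      (by exact_mod_cast (M _).2.2) (fun hpos => h.splits _ hpos x rfl L p hp)
      (h.maximal _ x rfl L p hp)
  · obtain ⟨γ, hγ⟩ := h.not_zero
    exact ⟨γ, by rwa [hfix]⟩
  · exact congrArg (fun γ => (M γ : NNReal)) (hfix (toImage ψ x)).symm
  · simpa only [hfix] using h.piecewise_linear

end Comparison

end P1An

end

/-- For a finite endomorphism `φ` of the projective line the two theorems are equivalent. More
precisely, with the same deformation retraction: the radius function descends to a function on the
skeleton with the required properties, and conversely the composite of such a function with the
retraction is the radius function. -/
theorem proposition6p1 {k : Type u} [NontriviallyNormedField k] [IsUltrametricDist k]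
    [CompleteSpace k] [IsAlgClosed k] (c : ℝ) (hc₀ : 0 < c) (hc₁ : c < 1)
    (φ : P1An.FiniteMorphism k) :
    (P1An.RadiusTheorem c φ ↔ P1An.SkeletonTheorem c φ) ∧
    (∀ (I : P1An.GeneralizedInterval) (ψ : I.carrier × P1An.Space k → P1An.Space k)
      (f : P1An.Space k → NNReal), P1An.RadiusData c φ f ψ →
      ∃ M : P1An.image ψ → Set.Icc (0 : NNReal) 1,
        (∀ x, (M (P1An.toImage ψ x) : NNReal) = f x) ∧ P1An.SkeletonData c φ ψ M) ∧
    (∀ (I : P1An.GeneralizedInterval) (ψ : I.carrier × P1An.Space k → P1An.Space k)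
      (M : P1An.image ψ → Set.Icc (0 : NNReal) 1), P1An.SkeletonData c φ ψ M →
      P1An.RadiusData c φ (fun x => (M (P1An.toImage ψ x) : NNReal)) ψ) := by
  refine ⟨⟨?_, ?_⟩, fun I ψ f h => h.exists_skeletonData, fun I ψ M h => h.radiusData⟩
  · rintro ⟨f, I, ψ, h⟩
    obtain ⟨M, -, hM⟩ := h.exists_skeletonData
    exact ⟨I, ψ, M, hM⟩
  · rintro ⟨I, ψ, M, h⟩
    exact ⟨_, I, ψ, h.radiusData⟩
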